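/- Let $k$ be a field and let $R$ be a discrete valuation ring which is a $k$-algebra, with maximal ideal $XR$, such that $k \to R/XR$ is an isomorphism. Let $\alpha$ be a $k$-algebra automorphism of $R$ of infinite order, let $S = R[\theta;\alpha]$ be the skew polynomial ring (so $\theta r = \alpha(r)\theta$ for $r\in R$), and let $T = S\langle X^{-1}\rangle = Q[\theta;\alpha]$ be its localisation at the powers of $X$, where $Q$ is the quotient field of $R$. All modules are right modules. Definitions. A nonzero non-unit $z$ of a ring is irreducible if $z=ab$ implies that $a$ or $b$ is a unit. An irreducible element $z$ of $S$ is of type (C) if it is not of the form $u\theta$ with $u$ a unit of $S$, and $uz = f + Xs$ for some unit $u$ of $S$, some monic $f\in k[\theta]\setminus k$ and some $s\in S$. A module $M$ is $1$-critical if its (Gabriel–Rentschler) Krull dimension is $1$ and every factor $M/N$ with $N\neq 0$ has Krull dimension less than $1$. Modules (in particular critical modules) are hull-similar if they contain isomorphic nonzero submodules. Elements $a,b\in T$ are similar if there is $0\ne u\in T$ with $uT+bT=T$ and $uaT = uT\cap bT$. Theorem. (1) Let $M$ be a finitely generated $1$-critical $S$-module. (a) If $M$ is unfaithful, then $M\cong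 S/XS$ or $M\cong S/\theta S$. (b) If $M$ is faithful, then $M$ is hull-similar to $S/zS$ for some type (C) irreducible element $z$ of $S$; more precisely, $S/zS$ is isomorphic to a submodule of $M$. (2) If $z$ is a type (C) irreducible element of $S$, then $S/zS$ is a faithful cyclic $1$-critical $S$-module. (3) Let $z$ and $w$ be irreducible elements of $S$ with $z$ of type (C). The following are equivalent: (a) $S/zS$ and $S/wS$ are hull-similar; (b) $T/zT$ and $T/wT$ are isomorphic simple $T$-modules; (c) $z$ and $w$ are similar in $T$. When these hold, $w$ is of type (C). -/

import Mathlib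

noncomputable section

/-! ### Skew polynomial rings `A[θ; σ]` and their coefficient maps -/

/-- A copy of `A` on which `n : ℕ` acts as `σ ^ n`. -/
def Twisted {A : Type*} [CommRing A] (_σ : A ≃+* A) : Type _ := A

instance Twisted.instCommRing {A : Type*} [CommRing A] (σ : A ≃+* A) : CommRing (Twisted σ) :=
  inferInstanceAs (CommRing A)

instance Twisted.instAction {A : Type*} [CommRing A] (σ : A ≃+* A) :
    MulSemiringAction (Multiplicative ℕ) (Twisted σ) :=
  MulSemiringAction.compHom A (powersHom (RingAut A) σ)

/-- The skew polynomial ring `A[θ; σ]`: polynomials `∑ aᵢ θⁱ` with `θ a = σ(a) θ`. -/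
abbrev SkewPoly {A : Type*} [CommRing A] (σ : A ≃+* A) : Type _ := SkewPolynomial (Twisted σ)

namespace SkewPoly

variable {A B : Type*} [CommRing A] [CommRing B]

/-- The inclusion of the coefficient ring in `A[θ; σ]`. -/
def coeffHom (σ : A ≃+* A) : A →+* SkewPoly σ :=
  (SkewPolynomial.CRingHom : Twisted σ →+* SkewPoly σ)

/-- The indeterminate `θ`. -/
def theta (σ : A ≃+* A) : SkewPoly σ := SkewPolynomial.X

theorem twisted_smul (σ : A ≃+* A) (n : Multiplicative ℕ) (a : A) :
    (n • (show Twisted σ from a) : Twisted σ) = (σ ^ n.toAdd) a := rfl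

theorem theta_mul_coeffHom (σ : A ≃+* A) (a : A) :
    theta σ * coeffHom σ a = coeffHom σ (σ a) * theta σ := by
  have h := SkewPolynomial.X_mul_monomial (R := Twisted σ) 0 a
  have h' := SkewPolynomial.monomial_mul_X (R := Twisted σ) 0 (σ a)
  exact h.trans h'.symm

theorem theta_pow_mul_coeffHom (σ : A ≃+* A) (n : ℕ) (a : A) :
    theta σ ^ n * coeffHom σ a = coeffHom σ ((σ ^ n) a) * theta σ ^ n := by
  induction n with
  | zero => simp
  | succ n ih =>
    rw [pow_succ', mul_assoc, ih, ← mul_assoc, theta_mul_coeffHom, mul_assoc]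
    rw [pow_succ' σ n]
    rfl

/-- The ring homomorphism `A[θ; σ] → B[θ; τ]`, `∑ aᵢ θⁱ ↦ ∑ f(aᵢ) θⁱ`, for a ring homomorphism
`f : A → B` with `f ∘ σ = τ ∘ f`. -/
def map {σ : A ≃+* A} {τ : B ≃+* B} (f : A →+* B) (h : ∀ a, f (σ a) = τ (f a)) :
    SkewPoly σ →+* SkewPoly τ :=
  SkewMonoidAlgebra.liftNCRingHom (k := Twisted σ) ((coeffHom τ).comp f)
    (powersHom (SkewPoly τ) (theta τ)) (by
      intro x n
      have hn : ∀ (m : ℕ) (a : A), f ((σ ^ m) a) = (τ ^ m) (f a) := by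
        intro m
        induction m with
        | zero => intro a; rfl
        | succ m ih => intro a; rw [pow_succ', pow_succ']; exact (h _).trans (congrArg τ (ih a))
      have := theta_pow_mul_coeffHom τ n.toAdd (f x)
      exact (congrArg (fun b => coeffHom τ b * theta τ ^ n.toAdd) (hn n.toAdd x)).trans this.symm)

theorem map_monomial {σ : A ≃+* A} {τ : B ≃+* B} (f : A →+* B) (h : ∀ a, f (σ a) = τ (f a))
    (n : ℕ) (a : A) :
    map f h (SkewPolynomial.monomial (R := Twisted σ) n a) =
      SkewPolynomial.monomial (R := Twisted τ) n (f a) :=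
  (SkewMonoidAlgebra.liftNC_single (k := Twisted σ) _ _ (Multiplicative.ofAdd n) a).trans
    (SkewPolynomial.C_mul_X_pow_eq_monomial (R := Twisted τ) (a := f a) (n := n))

theorem coeff_map {σ : A ≃+* A} {τ : B ≃+* B} (f : A →+* B) (h : ∀ a, f (σ a) = τ (f a))
    (p : SkewPoly σ) (n : ℕ) :
    (SkewPolynomial.coeff (map f h p) n : Twisted τ) =
      f (SkewPolynomial.coeff p n : Twisted σ) := by
  induction p using SkewPolynomial.induction with
  | h0 => rw [_root_.map_zero]; exact (_root_.map_zero f).symm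
  | ha m r q _ _ ih =>
    have e1 := congrArg (fun p => SkewPolynomial.coeff p n)
      (_root_.map_add (map f h) (SkewPolynomial.monomial m r) q)
    refine e1.trans ?_
    rw [SkewPolynomial.coeff_add, SkewPolynomial.coeff_add, ih]
    refine Eq.trans ?_ (_root_.map_add f _ _).symm
    congr 1
    refine (congrArg (fun p => SkewPolynomial.coeff p n) (map_monomial f h m r)).trans ?_
    refine (SkewPolynomial.coeff_monomial (R := Twisted τ) (n := m) (m := n) (a := f r)).trans ?_
    rw [SkewPolynomial.coeff_monomial]
    by_cases hmn : m = n
    · exact (if_pos hmn).trans (congrArg f (if_pos hmn).symm)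
    · exact (if_neg hmn).trans
        ((_root_.map_zero f).symm.trans (congrArg f (if_neg hmn).symm))

end SkewPoly

/-! ### Right modules `D / aD` and similarity -/

/-- The right `D`-module `D / aD`. Right `D`-modules are modules over `Dᵐᵒᵖ`. -/
abbrev RightQuot {D : Type*} [Ring D] (a : D) : Type _ := D ⧸ Submodule.span Dᵐᵒᵖ {a}

/-- `a` is (right) similar to `b` in `D`: there is `u ≠ 0` with `uD + bD = D` and
`uaD = uD ∩ bD`. -/
def IsSimilar {D : Type*} [Ring D] (a b : D) : Prop :=
  ∃ u : D, u ≠ 0 ∧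
    Submodule.span Dᵐᵒᵖ {u} ⊔ Submodule.span Dᵐᵒᵖ {b} = ⊤ ∧
    Submodule.span Dᵐᵒᵖ {u * a} = Submodule.span Dᵐᵒᵖ {u} ⊓ Submodule.span Dᵐᵒᵖ {b}

/-! ### Krull dimension (Gabriel–Rentschler) and critical modules -/

/-- `KdimLT A n M`: the Gabriel–Rentschler Krull dimension of the `A`-module `M` is less than `n`.
`Kdim M < 0` means `M = 0`, and `Kdim M < n + 1` means that in every descending chain of
submodules of `M` all but finitely many factors have `Kdim < n`. -/
def KdimLT (A : Type*) [Ring A] :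
    ℕ → ∀ (M : Type*) [AddCommGroup M] [Module A M], Prop
  | 0, M, _, _ => Subsingleton M
  | n + 1, M, _, _ => ∀ F : ℕ → Submodule A M, Antitone F →
      ∃ i₀, ∀ i ≥ i₀, KdimLT A n (F i ⧸ (F (i + 1)).submoduleOf (F i))

/-- `M` has Krull dimension `n`. -/
def HasKdim (A : Type*) [Ring A] (n : ℕ) (M : Type*) [AddCommGroup M] [Module A M] : Prop :=
  KdimLT A (n + 1) M ∧ ¬ KdimLT A n M

/-- `M` is `n`-critical: `Kdim M = n`, and `Kdim (M / N) < n` for every nonzero submodule `N`. -/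
def IsKrullCritical (A : Type*) [Ring A] (n : ℕ) (M : Type*) [AddCommGroup M] [Module A M] :
    Prop :=
  HasKdim A n M ∧ ∀ N : Submodule A M, N ≠ ⊥ → KdimLT A n (M ⧸ N)

/-- Hull-similarity of (critical) modules: they contain isomorphic nonzero submodules. -/
def HullSimilar (A : Type*) [Ring A] (M N : Type*) [AddCommGroup M] [Module A M]
    [AddCommGroup N] [Module A N] : Prop :=
  ∃ (M' : Submodule A M) (N' : Submodule A N), M' ≠ ⊥ ∧ Nonempty (M' ≃ₗ[A] N')

/-! ### The rings `S = R[θ; α]` and `T = Q(R)[θ; α]`, and type (C) irreducible elements -/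

section Setup

variable {k R : Type*} [Field k] [CommRing R] [Algebra k R]

/-- `S = R[θ; α]`. -/
abbrev SRing (α : R ≃ₐ[k] R) : Type _ := SkewPoly (α : R ≃+* R)

/-- The extension of `α` to the quotient field `Q = Q(R)`. -/
def fracAut (α : R ≃ₐ[k] R) : FractionRing R ≃+* FractionRing R :=
  IsFractionRing.ringEquivOfRingEquiv (α : R ≃+* R)

/-- `T = Q[θ; α]`. If `R` is a discrete valuation ring with maximal ideal `XR`, this is the
localisation of `S` at the powers of `X`; see `SRing.toT_injective`, `SRing.isUnit_toT` and
`SRing.exists_toT_eq_mul_pow`. -/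
abbrev TRing (α : R ≃ₐ[k] R) : Type _ := SkewPoly (fracAut α)

/-- The inclusion `S → T`. -/
def SRing.toT (α : R ≃ₐ[k] R) : SRing α →+* TRing α :=
  SkewPoly.map (algebraMap R (FractionRing R)) (fun a => by
    simp [fracAut])

theorem SRing.toT_injective (α : R ≃ₐ[k] R) : Function.Injective (SRing.toT α) := by
  intro p q hpq
  refine SkewPolynomial.ext fun n => ?_
  have := congrArg (fun p => SkewPolynomial.coeff p n) hpq
  exact IsFractionRing.injective R (FractionRing R)
    ((SkewPoly.coeff_map _ _ p n).symm.trans (this.trans (SkewPoly.coeff_map _ _ q n)))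

theorem SRing.toT_coeffHom (α : R ≃ₐ[k] R) (r : R) :
    SRing.toT α (SkewPoly.coeffHom _ r) = SkewPoly.coeffHom _ (algebraMap R _ r) :=
  SkewPoly.map_monomial _ _ 0 r

theorem SRing.isUnit_toT [IsDomain R] (α : R ≃ₐ[k] R) {X : R} (hX : X ≠ 0) :
    IsUnit (SRing.toT α (SkewPoly.coeffHom _ X)) := by
  rw [SRing.toT_coeffHom]
  refine IsUnit.map _ (IsUnit.mk0 _ ?_)
  simpa using hX

theorem fracAut_pow_algebraMap (α : R ≃ₐ[k] R) (i : ℕ) (r : R) :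
    ((fracAut α) ^ i) (algebraMap R (FractionRing R) r) =
      algebraMap R (FractionRing R) ((α ^ i) r) := by
  induction i with
  | zero => rfl
  | succ i ih =>
    rw [pow_succ', pow_succ']
    refine (congrArg (fracAut α) ih).trans ?_
    simp [fracAut]

theorem SRing.exists_toT_eq_mul_pow [IsDomain R] [IsDiscreteValuationRing R] (α : R ≃ₐ[k] R) {X : R}
    (hX : IsLocalRing.maximalIdeal R = Ideal.span {X}) (t : TRing α) :
    ∃ (n : ℕ) (s : SRing α), SRing.toT α s = t * SRing.toT α (SkewPoly.coeffHom _ X) ^ n := by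
  have hXi : Irreducible X := (IsDiscreteValuationRing.irreducible_iff_uniformizer X).2 hX
  induction t using SkewPolynomial.induction with
  | h0 => exact ⟨0, 0, by simp⟩
  | ha m c q _ _ ih =>
    obtain ⟨n, s, hs⟩ := ih
    obtain ⟨a, b, hb, hab⟩ := IsFractionRing.div_surjective (A := R) (K := FractionRing R) c
    have hY : Irreducible ((α ^ m) X) := (MulEquiv.irreducible_iff (α ^ m)).2 hXi
    obtain ⟨l, u, hu⟩ :=
      IsDiscreteValuationRing.eq_unit_mul_pow_irreducible (nonZeroDivisors.ne_zero hb) hY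
    have key : ∃ (r : R), SRing.toT α (SkewPolynomial.monomial (R := Twisted _) m r) =
        SkewPolynomial.monomial m c * SRing.toT α (SkewPoly.coeffHom _ X) ^ l := by
      refine ⟨a * (↑u⁻¹ : R), ?_⟩
      rw [← _root_.map_pow, ← _root_.map_pow, SRing.toT_coeffHom]
      refine (SkewPoly.map_monomial _ _ m _).trans ?_
      refine Eq.trans ?_ (SkewPolynomial.monomial_mul_C (R := Twisted (fracAut α))
        (a := c) (n := m) (b := algebraMap R (FractionRing R) (X ^ l))).symm
      refine congrArg (SkewPolynomial.monomial (R := Twisted (fracAut α)) m) ?_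
      refine Eq.trans ?_ (congrArg (c * ·) (SkewPolynomial.φ_iterate_apply
        (R := Twisted (fracAut α)) m (algebraMap R (FractionRing R) (X ^ l))).symm)
      change algebraMap R (FractionRing R) (a * (↑u⁻¹ : R)) =
        (show FractionRing R from c) *
          ((fracAut α) ^ m) (algebraMap R (FractionRing R) (X ^ l))
      rw [fracAut_pow_algebraMap]
      have hb0 : algebraMap R (FractionRing R) b ≠ 0 := by
        simpa using nonZeroDivisors.ne_zero hb
      have hc : (show FractionRing R from c) = algebraMap R _ a / algebraMap R _ b := hab.symm
      rw [hc, div_mul_eq_mul_div, eq_div_iff hb0, ← _root_.map_mul, ← _root_.map_mul, hu,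
        _root_.map_pow]
      congr 1
      rw [mul_assoc, ← mul_assoc (↑u⁻¹ : R), Units.inv_mul, one_mul]
    obtain ⟨r, hr⟩ := key
    refine ⟨l + n, SkewPolynomial.monomial (R := Twisted _) m r * (SkewPoly.coeffHom _ X) ^ n
      + s * (SkewPoly.coeffHom _ X) ^ l, ?_⟩
    rw [_root_.map_add, _root_.map_mul, _root_.map_mul, hr, hs, _root_.map_pow, _root_.map_pow,
      add_mul, mul_assoc, mul_assoc, ← pow_add, ← pow_add, add_comm n l]

/-- The element `X` of `S`. -/
def SRing.X (α : R ≃ₐ[k] R) (X : R) : SRing α := SkewPoly.coeffHom _ X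

/-- The element `θ` of `S`. -/
def SRing.theta (α : R ≃ₐ[k] R) : SRing α := SkewPoly.theta _

/-- The inclusion `k[θ] → S`. -/
def SRing.ofPoly (α : R ≃ₐ[k] R) (f : Polynomial k) : SRing α :=
  f.eval₂ ((SkewPoly.coeffHom (α : R ≃+* R)).comp (algebraMap k R)) (SRing.theta α)

/-- `z` is an irreducible element of `S` of type (C): `z` is not a unit multiple of `θ`, and
`u z = f + X s` for some unit `u` of `S`, some monic `f ∈ k[θ] ∖ k` and some `s ∈ S`. -/
def SRing.IsTypeC (α : R ≃ₐ[k] R) (X : R) (z : SRing α) : Prop :=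
  Irreducible z ∧ (∀ u : (SRing α)ˣ, (u : SRing α) * z ≠ SRing.theta α) ∧
    ∃ (u : (SRing α)ˣ) (f : Polynomial k) (s : SRing α), f.Monic ∧ 0 < f.natDegree ∧
      (u : SRing α) * z = SRing.ofPoly α f + SRing.X α X * s

end Setup

end

/-!
Reduction modulo the normal element `X` is a ring homomorphism `S → k[θ]` with kernel `XS = SX`,
because `α` is `k`-linear and so induces the identity on `R / XR = k`. The proof plays this
homomorphism against the degree in `θ`.

A module of Krull dimension at most `0` is an Artinian one, so a module is `1`-critical exactly
when it is not Artinian but all its proper factor modules are (`isKrullCritical_one_iff`). A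
normal element acts on such a module either as zero or injectively
(`IsKrullCritical.smul_eq_zero_or_injective`).

Since `α` has infinite order, every nonzero two-sided ideal of `S` contains some `Xⁿ θᵐ`. Hence an
unfaithful `1`-critical module is annihilated by `X` or by `θ`, and is a finitely generated
critical module over the principal ideal domain `S / XS = k[θ]` or `S / θS = R`, which forces it
to be free of rank one.

The link with `T`, where every right ideal is principal, is made inside `S`: a nonzero right ideal
`K` such that `S / K` has no `X`-torsion is principal, generated by an element that is nonzero
modulo `X` (`SRing.exists_eq_span_of_saturated`). For a nonzero element of a faithful critical
module the annihilator is such an ideal `zS`, and a choice of least degree makes `z` irreducible.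
If `z` were constant modulo `X`, then every right ideal containing `z` would be saturated, hence
principal, and comparison of degrees would make `S / zS` Artinian
(`SRing.isArtinian_rightQuot_of_red_eq_C`). So `z` is of type (C).

Conversely, let `z` be of type (C). Then `X` acts injectively but not surjectively on `S / zS`,
which is therefore not Artinian. A right ideal properly containing `zS` contains a power of `X`
(`SRing.exists_X_pow_mem`), and the corresponding factor module is filtered by proper quotients of
`k[θ]`. So `S / zS` is `1`-critical.

Finally, `zT ∩ S = zS` and right multiplication by powers of `X` clears denominators, so
annihilators of elements of `S` in `T / zT` and in `S / zS` determine each other. This identifies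
hull-similarity of `S / zS` and `S / wS` with isomorphism of the simple modules `T / zT` and `T /
wT`, and the latter is similarity of `z` and `w` in the domain `T`.
-/

section

open scoped RightActions
open MulOpposite

/-! ### Krull dimension at most one and Artinian modules -/

section Krull

variable {A M : Type*} [Ring A] [AddCommGroup M] [Module A M]

theorem kdimLT_one_iff : KdimLT A 1 M ↔ IsArtinian A M := by
  have key : ∀ F : ℕ → Submodule A M, ∀ i,
      KdimLT A 0 (F i ⧸ (F (i + 1)).submoduleOf (F i)) ↔ F i ≤ F (i + 1) := fun F i =>
    Submodule.Quotient.subsingleton_iff.trans Submodule.submoduleOf_eq_top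
  rw [← monotone_stabilizes_iff_artinian]
  constructor
  · intro h f
    obtain ⟨n, hn⟩ := h f f.monotone
    refine ⟨n, fun m hm => ?_⟩
    induction m, hm using Nat.le_induction with
    | base => rfl
    | succ m hm ih =>
      exact ih.trans (le_antisymm (f.monotone (Nat.le_succ m)) ((key f m).1 (hn m hm)))
  · intro h F hF
    obtain ⟨n, hn⟩ := h ⟨F, hF⟩
    refine ⟨n, fun i hi => (key F i).2 ?_⟩
    have h1 : F n = F i := hn i hi
    have h2 : F n = F (i + 1) := hn (i + 1) (by omega)
    exact (h1.symm.trans h2).le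

theorem isKrullCritical_one_iff :
    IsKrullCritical A 1 M ↔
      ¬ IsArtinian A M ∧ ∀ N : Submodule A M, N ≠ ⊥ → IsArtinian A (M ⧸ N) := by
  simp only [IsKrullCritical, HasKdim, kdimLT_one_iff]
  refine ⟨fun h => ⟨h.1.2, h.2⟩, fun h => ⟨⟨fun F hF => ?_, h.1⟩, h.2⟩⟩
  by_cases hb : ∃ i, F i = ⊥
  · obtain ⟨i₀, h0⟩ := hb
    refine ⟨i₀, fun i hi => kdimLT_one_iff.2 ?_⟩
    have : F i = ⊥ := by rw [eq_bot_iff, ← h0]; exact hF hi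
    have : Subsingleton (F i) := by rw [this]; infer_instance
    infer_instance
  · push Not at hb
    refine ⟨0, fun i _ => kdimLT_one_iff.2 ?_⟩
    have := h.2 _ (hb (i + 1))
    let g : F i →ₗ[A] M ⧸ F (i + 1) := (F (i + 1)).mkQ ∘ₗ (F i).subtype
    have hk : (F (i + 1)).submoduleOf (F i) = LinearMap.ker g := by
      ext x; simp [g, Submodule.submoduleOf]
    refine isArtinian_of_injective (((F (i + 1)).submoduleOf (F i)).liftQ g hk.le) ?_
    rw [← LinearMap.ker_eq_bot, Submodule.ker_liftQ_eq_bot _ _ _ hk.ge]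

/-- A nonzero submodule of a `1`-critical module is not Artinian. -/
theorem IsKrullCritical.not_isArtinian (h : IsKrullCritical A 1 M) {N : Submodule A M}
    (hN : N ≠ ⊥) : ¬ IsArtinian A N := fun hA => by
  rw [isKrullCritical_one_iff] at h
  exact h.1 ((isArtinian_iff_submodule_quotient N).2 ⟨hA, h.2 N hN⟩)

end Krull

/-! ### Normal elements acting on right modules -/

section Normal

variable {D : Type*} [Ring D]

theorem mem_span_op_singleton {D : Type*} [Ring D] {z s : D} :
    s ∈ Submodule.span Dᵐᵒᵖ {z} ↔ ∃ q, s = z * q := by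
  rw [Submodule.mem_span_singleton]
  constructor
  · rintro ⟨a, rfl⟩; exact ⟨a.unop, rfl⟩
  · rintro ⟨q, rfl⟩; exact ⟨op q, rfl⟩

/-- `c` is normal: `cD = Dc`. -/
structure IsNormalElement (c : D) : Prop where
  exists_mul_eq : ∀ s, ∃ s', s * c = c * s'
  exists_eq_mul : ∀ s, ∃ s', c * s = s' * c

variable {M : Type*} [AddCommGroup M] [Module Dᵐᵒᵖ M] {c : D}

/-- The submodule `{m | m c ∈ L}`, for a normal element `c`. -/
def IsNormalElement.preimage (hc : IsNormalElement c) (L : Submodule Dᵐᵒᵖ M) :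
    Submodule Dᵐᵒᵖ M where
  carrier := {m | m <• c ∈ L}
  zero_mem' := by simp
  add_mem' := fun {a b} ha hb => by
    have := L.add_mem ha hb
    simpa [smul_add] using this
  smul_mem' := fun s m hm => by
    obtain ⟨s', hs'⟩ := hc.exists_mul_eq s.unop
    have : (s • m) <• c = (m <• c) <• s' := by
      rw [smul_smul, smul_smul, ← op_mul, ← hs', op_mul, op_unop]
    change (s • m) <• c ∈ L
    rw [this]
    exact L.smul_mem _ hm

theorem IsNormalElement.mem_preimage (hc : IsNormalElement c) {L : Submodule Dᵐᵒᵖ M} {m : M} :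
    m ∈ hc.preimage L ↔ m <• c ∈ L := Iff.rfl

/-- The submodule `Mc`, for a normal element `c`. -/
def IsNormalElement.range (hc : IsNormalElement c) (M : Type*) [AddCommGroup M] [Module Dᵐᵒᵖ M] :
    Submodule Dᵐᵒᵖ M where
  carrier := {x | ∃ m, x = m <• c}
  zero_mem' := ⟨0, by simp⟩
  add_mem' := by
    rintro _ _ ⟨a, rfl⟩ ⟨b, rfl⟩
    exact ⟨a + b, by rw [smul_add]⟩
  smul_mem' := by
    rintro s _ ⟨m, rfl⟩
    obtain ⟨s', hs'⟩ := hc.exists_eq_mul s.unop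
    exact ⟨m <• s', by rw [smul_smul, smul_smul, ← op_mul, ← hs', op_mul, op_unop]⟩

theorem IsNormalElement.pow (hc : IsNormalElement c) (n : ℕ) : IsNormalElement (c ^ n) := by
  induction n with
  | zero => exact ⟨fun s => ⟨s, by simp⟩, fun s => ⟨s, by simp⟩⟩
  | succ n ih =>
    constructor
    · intro s
      obtain ⟨a, ha⟩ := ih.1 s
      obtain ⟨b, hb⟩ := hc.1 a
      exact ⟨b, by rw [pow_succ, ← mul_assoc, ha, mul_assoc, hb, mul_assoc]⟩
    · intro s
      obtain ⟨a, ha⟩ := hc.2 s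
      obtain ⟨b, hb⟩ := ih.2 a
      exact ⟨b, by rw [pow_succ, mul_assoc, ha, ← mul_assoc, hb, mul_assoc]⟩

/-- Multiplication by `c` identifies the submodules of `M / N` with those of `Mc` when `Nc = 0`,
so `M` is Artinian as soon as `M / N` and `M / Mc` are. -/
theorem IsNormalElement.isArtinian (hc : IsNormalElement c) (N : Submodule Dᵐᵒᵖ M)
    (hN : ∀ m ∈ N, m <• c = 0) [IsArtinian Dᵐᵒᵖ (M ⧸ N)]
    [IsArtinian Dᵐᵒᵖ (M ⧸ hc.range M)] : IsArtinian Dᵐᵒᵖ M := by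
  let f : Submodule Dᵐᵒᵖ M → Submodule Dᵐᵒᵖ (M ⧸ N) × Submodule Dᵐᵒᵖ (M ⧸ hc.range M) :=
    fun L => ((hc.preimage L).map N.mkQ, L.map (hc.range M).mkQ)
  have hf : StrictMono f := by
    intro L L' h
    have hle : hc.preimage L ≤ hc.preimage L' := fun m hm => h.le hm
    refine lt_of_le_not_ge ⟨Submodule.map_mono hle, Submodule.map_mono h.le⟩ ?_
    rintro ⟨h1, h2⟩
    have h1' : hc.preimage L' ≤ hc.preimage L := by
      have hNL : N ≤ hc.preimage L := fun m hm => by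
        rw [hc.mem_preimage, hN m hm]; exact L.zero_mem
      have := Submodule.comap_mono (f := N.mkQ) h1
      simpa only [f, Submodule.comap_map_mkQ, sup_eq_right.2 hNL, sup_eq_right.2 (hNL.trans hle)]
        using this
    refine h.not_ge fun x hx => ?_
    have hx' : x ∈ hc.range M ⊔ L := by
      rw [← Submodule.comap_map_mkQ]
      exact h2 (Submodule.mem_map_of_mem hx)
    obtain ⟨_, ⟨m, rfl⟩, l, hl, rfl⟩ := Submodule.mem_sup.1 hx'
    have hm : m <• c ∈ L' := by simpa using L'.sub_mem hx (h.le hl)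
    exact L.add_mem (h1' hm) hl
  exact hf.wellFoundedLT

/-- A normal element acts on a `1`-critical module either as zero or injectively. -/
theorem IsKrullCritical.smul_eq_zero_or_injective (hM : IsKrullCritical Dᵐᵒᵖ 1 M)
    (hc : IsNormalElement c) : (∀ m : M, m <• c = 0) ∨ (∀ m : M, m <• c = 0 → m = 0) := by
  rw [isKrullCritical_one_iff] at hM
  by_cases h1 : hc.preimage (⊥ : Submodule Dᵐᵒᵖ M) = ⊥
  · right
    intro m hm
    have : m ∈ hc.preimage (⊥ : Submodule Dᵐᵒᵖ M) := by rw [hc.mem_preimage, hm]; simp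
    simpa [h1] using this
  · left
    by_contra h2
    push Not at h2
    obtain ⟨m, hm⟩ := h2
    have h3 : hc.range M ≠ ⊥ := fun h => hm (by
      have : m <• c ∈ hc.range M := ⟨m, rfl⟩
      simpa [h] using this)
    have := hM.2 _ h1
    have := hM.2 _ h3
    exact hM.1 (hc.isArtinian (hc.preimage ⊥) fun m hm =>
      (Submodule.mem_bot _).1 (hc.mem_preimage.1 hm))

/-- An injective normal element acts surjectively on an Artinian module. -/
theorem IsNormalElement.surjective_of_isArtinian [IsArtinian Dᵐᵒᵖ M] (hc : IsNormalElement c)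
    (hinj : ∀ m : M, m <• c = 0 → m = 0) (m : M) : ∃ m', m = m' <• c := by
  have hanti : Antitone fun n : ℕ => (hc.pow n).range M := by
    refine antitone_nat_of_succ_le fun n => ?_
    rintro _ ⟨m, rfl⟩
    exact ⟨m <• c, by rw [smul_smul, ← op_mul, ← pow_succ']⟩
  obtain ⟨n, hn⟩ := monotone_stabilizes_iff_artinian.2 ‹IsArtinian Dᵐᵒᵖ M› ⟨_, hanti⟩
  have h1 : m <• c ^ n ∈ (hc.pow (n + 1)).range M :=
    (show (hc.pow n).range M = (hc.pow (n + 1)).range M from hn (n + 1) n.le_succ).le ⟨m, rfl⟩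
  obtain ⟨m', hm'⟩ := h1
  refine ⟨m', ?_⟩
  have hinj' : ∀ n : ℕ, ∀ m : M, m <• c ^ n = 0 → m = 0 := by
    intro n
    induction n with
    | zero => simp
    | succ n ih =>
      intro m h
      rw [pow_succ, op_mul, ← smul_smul] at h
      exact ih _ (hinj _ h)
  rw [← sub_eq_zero]
  refine hinj' n _ ?_
  rw [smul_sub, hm', pow_succ', op_mul, ← smul_smul, sub_self]

end Normal

/-! ### Coefficients and degree in a skew polynomial ring -/

namespace SkewPoly

section Coeff

variable {A : Type*} [CommRing A] {σ : A ≃+* A}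

/-- The coefficient of `θ ^ n`, as an element of `A`. -/
def cf (p : SkewPoly σ) (n : ℕ) : A := SkewPolynomial.coeff p n

theorem ext_cf {p q : SkewPoly σ} (h : ∀ n, cf p n = cf q n) : p = q := SkewPolynomial.ext h

@[simp] theorem cf_zero (n : ℕ) : cf (0 : SkewPoly σ) n = 0 := rfl

@[simp] theorem cf_add (p q : SkewPoly σ) (n : ℕ) : cf (p + q) n = cf p n + cf q n :=
  SkewPolynomial.coeff_add p q n

@[simp] theorem cf_sub (p q : SkewPoly σ) (n : ℕ) : cf (p - q) n = cf p n - cf q n :=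
  SkewPolynomial.coeff_sub p q n

theorem cf_sum {ι : Type*} (s : Finset ι) (f : ι → SkewPoly σ) (n : ℕ) :
    cf (∑ i ∈ s, f i) n = ∑ i ∈ s, cf (f i) n := by
  classical
  induction s using Finset.induction_on with
  | empty => simp
  | insert a s ha ih => rw [Finset.sum_insert ha, Finset.sum_insert ha, cf_add, ih]

theorem cf_mul (p q : SkewPoly σ) (n : ℕ) :
    cf (p * q) n =
      ∑ x ∈ Finset.HasAntidiagonal.antidiagonal n, cf p x.1 * (σ ^ x.1) (cf q x.2) := by
  have := SkewMonoidAlgebra.coeff_mul_antidiagonal_of_finset p q (Multiplicative.ofAdd n)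
    ((Finset.HasAntidiagonal.antidiagonal n).map
      (Equiv.prodCongr Multiplicative.ofAdd Multiplicative.ofAdd).toEmbedding)
    (by
      rintro ⟨a, b⟩
      simp only [Finset.mem_map, Finset.HasAntidiagonal.mem_antidiagonal]
      constructor
      · rintro ⟨⟨i, j⟩, h, h'⟩
        cases h'
        exact congrArg Multiplicative.ofAdd h
      · intro h
        exact ⟨(a.toAdd, b.toAdd), congrArg Multiplicative.toAdd h, rfl⟩)
  refine this.trans ?_
  rw [Finset.sum_map]
  rfl

theorem cf_coeffHom_mul_theta_pow (a : A) (m n : ℕ) :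
    cf (coeffHom σ a * theta σ ^ m) n = if m = n then a else 0 :=
  (congrArg (fun p => SkewPolynomial.coeff p n)
    (SkewPolynomial.C_mul_X_pow_eq_monomial (R := Twisted σ) (a := a) (n := m))).trans
    SkewPolynomial.coeff_monomial

theorem cf_coeffHom (a : A) (n : ℕ) : cf (coeffHom σ a) n = if 0 = n then a else 0 := by
  simpa using cf_coeffHom_mul_theta_pow (σ := σ) a 0 n

theorem cf_one (n : ℕ) : cf (1 : SkewPoly σ) n = if 0 = n then 1 else 0 := by
  simpa using cf_coeffHom (σ := σ) 1 n

theorem cf_mul_coeffHom_mul_theta_pow (p : SkewPoly σ) (a : A) (m n : ℕ) :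
    cf (p * (coeffHom σ a * theta σ ^ m)) (n + m) = cf p n * (σ ^ n) a := by
  rw [cf_mul, Finset.sum_eq_single (n, m)]
  · simp [cf_coeffHom_mul_theta_pow]
  · rintro ⟨i, j⟩ h hne
    rw [cf_coeffHom_mul_theta_pow, if_neg]
    · simp
    · rintro rfl
      simp only [Finset.HasAntidiagonal.mem_antidiagonal] at h
      exact hne (by ext <;> simp; omega)
  · simp

theorem cf_mul_coeffHom (p : SkewPoly σ) (a : A) (n : ℕ) :
    cf (p * coeffHom σ a) n = cf p n * (σ ^ n) a := by
  simpa using cf_mul_coeffHom_mul_theta_pow p a 0 n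

theorem cf_coeffHom_mul (a : A) (p : SkewPoly σ) (n : ℕ) :
    cf (coeffHom σ a * p) n = a * cf p n := by
  rw [cf_mul, Finset.sum_eq_single (0, n)]
  · simp [cf_coeffHom]
  · rintro ⟨i, j⟩ h hne
    rw [cf_coeffHom, if_neg]
    · simp
    · rintro rfl
      simp only [Finset.HasAntidiagonal.mem_antidiagonal] at h
      exact hne (by ext <;> simp; omega)
  · simp

theorem cf_mul_theta_succ (p : SkewPoly σ) (n : ℕ) : cf (p * theta σ) (n + 1) = cf p n := by
  simpa using cf_mul_coeffHom_mul_theta_pow p 1 1 n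

theorem cf_theta (n : ℕ) : cf (theta σ) n = if 1 = n then 1 else 0 := by
  simpa using cf_coeffHom_mul_theta_pow (σ := σ) 1 1 n

theorem cf_theta_mul_succ (p : SkewPoly σ) (n : ℕ) :
    cf (theta σ * p) (n + 1) = σ (cf p n) := by
  rw [cf_mul, Finset.sum_eq_single (1, n)]
  · simp [cf_theta]
  · rintro ⟨i, j⟩ h hne
    rw [cf_theta, if_neg]
    · simp
    · rintro rfl
      simp only [Finset.HasAntidiagonal.mem_antidiagonal] at h
      exact hne (by ext <;> simp; omega)
  · simp [add_comm]

/-- The constant coefficient is multiplicative: it is reduction modulo `θ`. -/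
noncomputable def constCoeff (σ : A ≃+* A) : SkewPoly σ →+* A where
  toFun p := cf p 0
  map_one' := by simp [cf_one]
  map_mul' p q := by simp [cf_mul]
  map_zero' := rfl
  map_add' p q := cf_add p q 0

theorem constCoeff_apply (p : SkewPoly σ) : constCoeff σ p = cf p 0 := rfl

/-- The skew polynomial `∑ f(n) θⁿ` over `n < d`. -/
noncomputable def ofFun (σ : A ≃+* A) (f : ℕ → A) (d : ℕ) : SkewPoly σ :=
  ∑ n ∈ Finset.range d, coeffHom σ (f n) * theta σ ^ n

theorem cf_ofFun (f : ℕ → A) (d n : ℕ) : cf (ofFun σ f d) n = if n < d then f n else 0 := by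
  rw [ofFun, cf_sum]
  simp [cf_coeffHom_mul_theta_pow]

theorem mem_support_iff_cf {p : SkewPoly σ} {n : ℕ} :
    n ∈ SkewPolynomial.support p ↔ cf p n ≠ 0 := SkewPolynomial.mem_support_iff

/-- The degree in `θ`, with `deg 0 = 0`. -/
def deg (p : SkewPoly σ) : ℕ := (SkewPolynomial.support p).sup id

theorem cf_eq_zero_of_deg_lt {p : SkewPoly σ} {n : ℕ} (h : deg p < n) : cf p n = 0 := by
  by_contra h0
  exact h.not_ge (Finset.le_sup (f := id) (SkewPolynomial.mem_support_iff.2 h0))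

theorem deg_le_of_forall {p : SkewPoly σ} {d : ℕ} (h : ∀ n, d < n → cf p n = 0) : deg p ≤ d :=
  Finset.sup_le fun n hn => not_lt.1 fun hd => SkewPolynomial.mem_support_iff.1 hn (h n hd)

theorem le_deg_of_cf_ne_zero {p : SkewPoly σ} {n : ℕ} (h : cf p n ≠ 0) : n ≤ deg p :=
  not_lt.1 fun hd => h (cf_eq_zero_of_deg_lt hd)

theorem cf_deg_ne_zero {p : SkewPoly σ} (h : p ≠ 0) : cf p (deg p) ≠ 0 := by
  have hne : (SkewPolynomial.support p).Nonempty := by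
    rw [Finset.nonempty_iff_ne_empty]
    simpa using h
  obtain ⟨n, hn, he⟩ := Finset.exists_mem_eq_sup _ hne id
  have : cf p n ≠ 0 := SkewPolynomial.mem_support_iff.1 hn
  rwa [deg, he]

theorem eq_coeffHom_of_deg_eq_zero {p : SkewPoly σ} (h : deg p = 0) :
    p = coeffHom σ (cf p 0) := by
  refine ext_cf fun n => ?_
  rw [cf_coeffHom]
  split_ifs with hn
  · rw [hn]
  · exact cf_eq_zero_of_deg_lt (by omega)

theorem cf_mul_deg_add_deg (p q : SkewPoly σ) :
    cf (p * q) (deg p + deg q) = cf p (deg p) * (σ ^ deg p) (cf q (deg q)) := by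
  rw [cf_mul, Finset.sum_eq_single (deg p, deg q)]
  · rintro ⟨i, j⟩ h hne
    simp only [Finset.HasAntidiagonal.mem_antidiagonal] at h
    rcases lt_or_ge (deg p) i with hi | hi
    · simp [cf_eq_zero_of_deg_lt hi]
    · have : deg q < j := by
        by_contra hj
        exact hne (by ext <;> simp <;> omega)
      simp [cf_eq_zero_of_deg_lt this]
  · simp

theorem deg_mul_le (p q : SkewPoly σ) : deg (p * q) ≤ deg p + deg q := by
  refine deg_le_of_forall fun n hn => ?_
  rw [cf_mul]
  refine Finset.sum_eq_zero ?_
  rintro ⟨i, j⟩ h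
  simp only [Finset.HasAntidiagonal.mem_antidiagonal] at h
  rcases lt_or_ge (deg p) i with hi | hi
  · simp [cf_eq_zero_of_deg_lt hi]
  · simp [cf_eq_zero_of_deg_lt (show deg q < j by omega)]

variable [IsDomain A]

theorem cf_mul_deg_add_deg_ne_zero {p q : SkewPoly σ} (hp : p ≠ 0) (hq : q ≠ 0) :
    cf (p * q) (deg p + deg q) ≠ 0 := by
  rw [cf_mul_deg_add_deg]
  exact mul_ne_zero (cf_deg_ne_zero hp)
    ((map_ne_zero_iff _ (σ ^ deg p).injective).2 (cf_deg_ne_zero hq))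

theorem deg_mul {p q : SkewPoly σ} (hp : p ≠ 0) (hq : q ≠ 0) : deg (p * q) = deg p + deg q :=
  le_antisymm (deg_mul_le p q) (le_deg_of_cf_ne_zero (cf_mul_deg_add_deg_ne_zero hp hq))

instance : NoZeroDivisors (SkewPoly σ) where
  eq_zero_or_eq_zero_of_mul_eq_zero {p q} h := by
    by_contra! hne
    exact cf_mul_deg_add_deg_ne_zero hne.1 hne.2 (by simp [h])

instance : Nontrivial (SkewPoly σ) :=
  ⟨0, 1, fun h => by simpa [cf_one] using congrArg (fun p => cf p 0) h⟩

instance : IsDomain (SkewPoly σ) := NoZeroDivisors.to_isDomain _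

end Coeff

section Theta

variable {A : Type*} [CommRing A] {σ : A ≃+* A}

theorem exists_eq_mul_theta {p : SkewPoly σ} (h : cf p 0 = 0) : ∃ q, p = q * theta σ := by
  refine ⟨ofFun σ (fun n => cf p (n + 1)) (deg p), ext_cf fun n => ?_⟩
  cases n with
  | zero => simp [cf_mul, cf_theta, h]
  | succ n =>
    rw [cf_mul_theta_succ, cf_ofFun]
    split_ifs with hn
    · rfl
    · exact cf_eq_zero_of_deg_lt (by omega)

theorem exists_eq_theta_mul {p : SkewPoly σ} (h : cf p 0 = 0) : ∃ q, p = theta σ * q := by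
  refine ⟨ofFun σ (fun n => σ.symm (cf p (n + 1))) (deg p), ext_cf fun n => ?_⟩
  cases n with
  | zero => simp [cf_mul, cf_theta, h]
  | succ n =>
    rw [cf_theta_mul_succ, cf_ofFun]
    split_ifs with hn
    · simp
    · rw [cf_eq_zero_of_deg_lt (by omega)]; simp

theorem isNormalElement_theta (σ : A ≃+* A) : IsNormalElement (theta σ) :=
  ⟨fun s => exists_eq_theta_mul (by simp [cf_mul, cf_theta]),
    fun s => exists_eq_mul_theta (by simp [cf_mul, cf_theta])⟩

theorem theta_ne_zero [Nontrivial A] (σ : A ≃+* A) : theta σ ≠ 0 := fun h => by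
  simpa [cf_theta] using congrArg (fun p => cf p 1) h

/-- The ring homomorphism `A[θ; σ] → B[X]`, `∑ aᵢ θⁱ ↦ ∑ ρ(aᵢ) Xⁱ`, for `ρ` invariant under
`σ`. -/
noncomputable def toPolynomial {B : Type*} [CommRing B] (ρ : A →+* B) (h : ∀ a, ρ (σ a) = ρ a) :
    SkewPoly σ →+* Polynomial B :=
  SkewMonoidAlgebra.liftNCRingHom (k := Twisted σ) (Polynomial.C.comp ρ)
    (powersHom (Polynomial B) Polynomial.X) (by
      intro x n
      have hn : ∀ (m : ℕ) (a : A), ρ ((σ ^ m) a) = ρ a := by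
        intro m
        induction m with
        | zero => intro a; rfl
        | succ m ih => intro a; rw [pow_succ']; exact (h _).trans (ih a)
      rw [mul_comm]
      exact congrArg (fun b => powersHom (Polynomial B) Polynomial.X n * Polynomial.C b)
        (hn n.toAdd x))

variable {B : Type*} [CommRing B] (ρ : A →+* B) (h : ∀ a, ρ (σ a) = ρ a)

theorem toPolynomial_coeffHom (a : A) : toPolynomial ρ h (coeffHom σ a) = Polynomial.C (ρ a) := by
  have := SkewMonoidAlgebra.liftNC_single (k := Twisted σ)
    ((Polynomial.C.comp ρ : A →+* Polynomial B) : A →+ Polynomial B)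
    (powersHom (Polynomial B) Polynomial.X) (Multiplicative.ofAdd 0) a
  exact this.trans (by rw [ofAdd_zero, map_one, mul_one]; rfl)

theorem toPolynomial_theta : toPolynomial ρ h (theta σ) = Polynomial.X := by
  have := SkewMonoidAlgebra.liftNC_single (k := Twisted σ)
    ((Polynomial.C.comp ρ : A →+* Polynomial B) : A →+ Polynomial B)
    (powersHom (Polynomial B) Polynomial.X) (Multiplicative.ofAdd 1) (1 : A)
  exact this.trans ((congrArg₂ _ (map_one (Polynomial.C.comp ρ)) (by simp)).trans (one_mul _))

theorem eq_ofFun (p : SkewPoly σ) : p = ofFun σ (cf p) (deg p + 1) := by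
  refine ext_cf fun n => ?_
  rw [cf_ofFun]
  split_ifs with hn
  · rfl
  · exact cf_eq_zero_of_deg_lt (by omega)

theorem coeff_toPolynomial (p : SkewPoly σ) (n : ℕ) :
    (toPolynomial ρ h p).coeff n = ρ (cf p n) := by
  conv_lhs => rw [eq_ofFun p]
  simp only [ofFun, map_sum, map_mul, map_pow, toPolynomial_coeffHom, toPolynomial_theta,
    Polynomial.finsetSum_coeff, Polynomial.coeff_C_mul, Polynomial.coeff_X_pow, mul_ite, mul_one,
    mul_zero, Finset.sum_ite_eq, Finset.mem_range]
  split_ifs with hn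
  · rfl
  · rw [cf_eq_zero_of_deg_lt (by omega), _root_.map_zero]

end Theta

end SkewPoly

/-! ### The ring `S`: reduction modulo `X` -/

namespace SRing

open SkewPoly IsLocalRing

section Residue

variable {k R : Type*} [Field k] [CommRing R] [IsLocalRing R] [Algebra k R]

/-- The residue map of `R`, with values in `k`. -/
noncomputable def res (hk : Function.Bijective (algebraMap k (ResidueField R))) : R →+* k :=
  ((RingEquiv.ofBijective _ hk).symm : ResidueField R →+* k).comp (residue R)

variable (hk : Function.Bijective (algebraMap k (ResidueField R)))

theorem res_eq_zero_iff (r : R) : res hk r = 0 ↔ r ∈ maximalIdeal R := by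
  simp [res]

theorem res_algebraMap (c : k) : res hk (algebraMap k R c) = c := by
  change (RingEquiv.ofBijective _ hk).symm (residue R (algebraMap k R c)) = c
  rw [RingEquiv.symm_apply_eq]
  rfl

theorem mem_maximalIdeal_apply_iff (α : R ≃ₐ[k] R) (r : R) :
    α r ∈ maximalIdeal R ↔ r ∈ maximalIdeal R := by
  simp [mem_maximalIdeal]

theorem res_apply (α : R ≃ₐ[k] R) (r : R) : res hk ((α : R ≃+* R) r) = res hk r := by
  have h1 : r - algebraMap k R (res hk r) ∈ maximalIdeal R := by
    rw [← res_eq_zero_iff hk, map_sub, res_algebraMap, sub_self]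
  rw [← mem_maximalIdeal_apply_iff α, map_sub, AlgEquiv.commutes, ← res_eq_zero_iff hk, map_sub,
    res_algebraMap, sub_eq_zero] at h1
  exact h1

/-- Reduction modulo `X`, as a ring homomorphism `S → k[θ]`. -/
noncomputable def red (hk : Function.Bijective (algebraMap k (ResidueField R)))
    (α : R ≃ₐ[k] R) : SRing α →+* Polynomial k :=
  toPolynomial (res hk) (res_apply hk α)

theorem coeff_red {α : R ≃ₐ[k] R} (p : SRing α) (n : ℕ) :
    (red hk α p).coeff n = res hk (cf p n) :=
  coeff_toPolynomial _ _ p n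

theorem red_coeffHom {α : R ≃ₐ[k] R} (r : R) :
    red hk α (coeffHom _ r) = Polynomial.C (res hk r) :=
  toPolynomial_coeffHom _ _ r

theorem red_theta {α : R ≃ₐ[k] R} : red hk α (SRing.theta α) = Polynomial.X :=
  toPolynomial_theta _ _

theorem red_ofPoly {α : R ≃ₐ[k] R} (f : Polynomial k) : red hk α (ofPoly α f) = f := by
  rw [ofPoly, Polynomial.eval₂_eq_sum_range, map_sum]
  conv_rhs => rw [f.as_sum_range_C_mul_X_pow]
  simp [red_coeffHom, red_theta, res_algebraMap]

variable {X : R} (hX : maximalIdeal R = Ideal.span {X})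
include hX

theorem dvd_pow_apply_iff (α : R ≃ₐ[k] R) (n : ℕ) (r : R) :
    X ∣ ((α : R ≃+* R) ^ n) r ↔ X ∣ r := by
  simp only [← Ideal.mem_span_singleton, ← hX]
  induction n with
  | zero => rfl
  | succ n ih => rw [pow_succ', ← ih]; exact mem_maximalIdeal_apply_iff α _

theorem pow_apply_dvd_iff (α : R ≃ₐ[k] R) (n : ℕ) (r : R) :
    ((α : R ≃+* R) ^ n) X ∣ r ↔ X ∣ r := by
  have h1 : X ∣ ((α : R ≃+* R) ^ n) X := (dvd_pow_apply_iff hX α n X).2 dvd_rfl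
  obtain ⟨y, hy⟩ := ((α : R ≃+* R) ^ n).surjective X
  have h2 : X ∣ y := by rw [← dvd_pow_apply_iff hX α n, hy]
  obtain ⟨a, ha⟩ := h2
  have h3 : ((α : R ≃+* R) ^ n) X ∣ X := ⟨((α : R ≃+* R) ^ n) a, by rw [← map_mul, ← ha, hy]⟩
  exact ⟨h1.trans, h3.trans⟩

theorem res_eq_zero_iff_dvd (r : R) : res hk r = 0 ↔ X ∣ r := by
  rw [res_eq_zero_iff, hX, Ideal.mem_span_singleton]

omit [IsLocalRing R] hX in
theorem exists_eq_X_mul_of_forall_dvd {α : R ≃ₐ[k] R} {p : SRing α} (h : ∀ n, X ∣ cf p n) :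
    ∃ q, p = SRing.X α X * q := by
  choose f hf using h
  refine ⟨ofFun _ f (deg p + 1), ext_cf fun n => ?_⟩
  rw [SRing.X, cf_coeffHom_mul, cf_ofFun]
  split_ifs with hn
  · exact hf n
  · rw [cf_eq_zero_of_deg_lt (by omega), mul_zero]

theorem exists_eq_mul_X_of_forall_dvd {α : R ≃ₐ[k] R} {p : SRing α} (h : ∀ n, X ∣ cf p n) :
    ∃ q, p = q * SRing.X α X := by
  have h' : ∀ n, ((α : R ≃+* R) ^ n) X ∣ cf p n := fun n =>
    (pow_apply_dvd_iff hX α n _).2 (h n)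
  choose f hf using h'
  refine ⟨ofFun _ f (deg p + 1), ext_cf fun n => ?_⟩
  rw [SRing.X, cf_mul_coeffHom, cf_ofFun]
  split_ifs with hn
  · rw [hf n, mul_comm]
  · rw [cf_eq_zero_of_deg_lt (by omega), zero_mul]

theorem isNormalElement_X (α : R ≃ₐ[k] R) : IsNormalElement (SRing.X α X) := by
  constructor
  · intro s
    refine exists_eq_X_mul_of_forall_dvd fun n => ?_
    rw [SRing.X, cf_mul_coeffHom]
    exact ((dvd_pow_apply_iff hX α n X).2 dvd_rfl).mul_left _
  · intro s
    refine exists_eq_mul_X_of_forall_dvd hX fun n => ?_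
    rw [SRing.X, cf_coeffHom_mul]
    exact dvd_mul_right _ _

theorem forall_dvd_of_red_eq_zero {α : R ≃ₐ[k] R} {p : SRing α} (h : red hk α p = 0) (n : ℕ) :
    X ∣ cf p n := by
  rw [← res_eq_zero_iff_dvd hk hX, ← coeff_red, h, Polynomial.coeff_zero]

theorem exists_eq_X_mul {α : R ≃ₐ[k] R} {p : SRing α} (h : red hk α p = 0) :
    ∃ q, p = SRing.X α X * q :=
  exists_eq_X_mul_of_forall_dvd (forall_dvd_of_red_eq_zero hk hX h)

theorem exists_eq_mul_X {α : R ≃ₐ[k] R} {p : SRing α} (h : red hk α p = 0) :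
    ∃ q, p = q * SRing.X α X :=
  exists_eq_mul_X_of_forall_dvd hX (forall_dvd_of_red_eq_zero hk hX h)

theorem red_X (α : R ≃ₐ[k] R) : red hk α (SRing.X α X) = 0 := by
  rw [SRing.X, red_coeffHom, (res_eq_zero_iff_dvd hk hX X).2 dvd_rfl, Polynomial.C_0]

end Residue

/-! ### Saturated right ideals of `S` are principal -/

section Principal

variable {k R : Type*} [Field k] [CommRing R] [IsDomain R] [IsDiscreteValuationRing R]
  [Algebra k R] (hk : Function.Bijective (algebraMap k (ResidueField R)))
  {X : R} (hX : maximalIdeal R = Ideal.span {X}) {α : R ≃ₐ[k] R}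

include hX in
theorem irreducible_uniformizer : Irreducible X :=
  (IsDiscreteValuationRing.irreducible_iff_uniformizer X).2 hX

include hX in
theorem X_ne_zero (α : R ≃ₐ[k] R) : SRing.X α X ≠ 0 := fun h => by
  have := congrArg (fun p => cf p 0) h
  simp only [SRing.X, cf_coeffHom, if_true, cf_zero] at this
  exact (irreducible_uniformizer hX).ne_zero this

omit [IsDomain R] [IsDiscreteValuationRing R] in
theorem deg_coeffHom (r : R) : deg (coeffHom (α : R ≃+* R) r) = 0 :=
  Nat.le_zero.1 (deg_le_of_forall fun n hn => by rw [cf_coeffHom, if_neg hn.ne])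

include hX in
/-- Every nonzero element of `S` is `z Xⁿ` with `z` nonzero modulo `X`. -/
theorem exists_eq_mul_X_pow {s : SRing α} (hs : s ≠ 0) :
    ∃ n z, s = z * SRing.X α X ^ n ∧ deg z = deg s ∧ red hk α z ≠ 0 := by
  -- Induction on the leading coefficient: dividing by `X` makes it a proper divisor.
  suffices H : ∀ a : R, ∀ s : SRing α, s ≠ 0 → cf s (deg s) = a →
      ∃ n z, s = z * SRing.X α X ^ n ∧ deg z = deg s ∧ red hk α z ≠ 0 from H _ s hs rfl
  intro a
  induction a using (IsWellFounded.wf (r := DvdNotUnit (α := R))).induction with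
  | _ a ih =>
    intro s hs ha
    by_cases h : red hk α s = 0
    · obtain ⟨t, ht⟩ := exists_eq_mul_X hk hX h
      have ht0 : t ≠ 0 := by rintro rfl; simp [ht] at hs
      have hdeg : deg s = deg t := by
        rw [ht, deg_mul ht0 (X_ne_zero hX α), SRing.X, deg_coeffHom, add_zero]
      have hcf : a = cf t (deg t) * ((α : R ≃+* R) ^ deg t) X := by
        rw [← cf_mul_coeffHom, ← ha, hdeg, ht]; rfl
      obtain ⟨n, z, h1, h2, h3⟩ := ih (cf t (deg t)) ⟨cf_deg_ne_zero ht0, _, fun hu => by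
        rw [MulEquiv.isUnit_map] at hu
        exact (irreducible_uniformizer hX).not_isUnit hu, hcf⟩ t ht0 rfl
      exact ⟨n + 1, z, by rw [ht, h1, pow_succ, mul_assoc], h2.trans hdeg.symm, h3⟩
    · exact ⟨0, s, by simp, rfl, h⟩

include hX in
/-- If `z` is nonzero modulo `X`, then `S / zS` has no `X`-torsion. -/
theorem exists_eq_mul_of_mul_X_pow_eq {z : SRing α} (hz : red hk α z ≠ 0) {n : ℕ} {s q : SRing α}
    (h : s * SRing.X α X ^ n = z * q) : ∃ q', s = z * q' := by
  induction n generalizing q with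
  | zero => exact ⟨q, by simpa using h⟩
  | succ n ih =>
    have h1 := congrArg (red hk α) h
    rw [pow_succ, ← mul_assoc, map_mul _ _ (SRing.X α X), red_X hk hX, mul_zero, map_mul] at h1
    obtain ⟨q', hq'⟩ := exists_eq_mul_X hk hX ((mul_eq_zero.1 h1.symm).resolve_left hz)
    refine ih (q := q') (mul_right_cancel₀ (X_ne_zero hX α) ?_)
    rw [mul_assoc, ← pow_succ, h, hq', mul_assoc]

include hX in
/-- Right division with remainder, after multiplication by a power of `X`. -/
theorem exists_mul_X_pow_eq_mul_add {z : SRing α} (hz : z ≠ 0) (s : SRing α) :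
    ∃ n q r, s * SRing.X α X ^ n = z * q + r ∧ (r = 0 ∨ deg r < deg z) := by
  induction hd : deg s using Nat.strong_induction_on generalizing s with
  | _ d ih =>
    rcases lt_or_ge (deg s) (deg z) with hlt | hge
    · exact ⟨0, 0, s, by simp, Or.inr hlt⟩
    obtain ⟨m, hm⟩ := Nat.exists_eq_add_of_le hge
    have hY : Irreducible (((α : R ≃+* R) ^ deg s) X) :=
      (MulEquiv.irreducible_iff ((α : R ≃+* R) ^ deg s)).2 (irreducible_uniformizer hX)
    obtain ⟨l, u, hu⟩ :=
      IsDiscreteValuationRing.eq_unit_mul_pow_irreducible (cf_deg_ne_zero hz) hY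
    obtain ⟨c, hc⟩ := ((α : R ≃+* R) ^ deg z).surjective (cf s (deg s) * (↑u⁻¹ : R))
    have hpow : SRing.X α X ^ l = coeffHom _ (X ^ l) * SkewPoly.theta _ ^ 0 := by
      simp [SRing.X]
    set t := s * SRing.X α X ^ l - z * (coeffHom _ c * SkewPoly.theta _ ^ m) with ht
    have hcft : cf t (deg s) = 0 := by
      have hz' : cf (z * (coeffHom _ c * SkewPoly.theta _ ^ m)) (deg s) =
          cf z (deg z) * (cf s (deg s) * (↑u⁻¹ : R)) := by
        rw [← hc, ← cf_mul_coeffHom_mul_theta_pow, ← hm]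
      rw [ht, cf_sub, hz', hpow]
      have := cf_mul_coeffHom_mul_theta_pow s (X ^ l) 0 (deg s)
      rw [add_zero] at this
      rw [this, hu, map_pow]
      linear_combination (-cf s (deg s) * (((α : R ≃+* R) ^ deg s) X) ^ l) * u.mul_inv
    have hdegt : deg t ≤ deg s := by
      refine deg_le_of_forall fun n hn => ?_
      rw [ht, cf_sub, cf_eq_zero_of_deg_lt, cf_eq_zero_of_deg_lt, sub_zero]
      · refine ((deg_mul_le _ _).trans ?_).trans_lt hn
        rw [hm]
        refine Nat.add_le_add_left (deg_le_of_forall fun n hn => ?_) _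
        rw [cf_coeffHom_mul_theta_pow, if_neg hn.ne]
      · refine ((deg_mul_le _ _).trans ?_).trans_lt hn
        rw [SRing.X, ← map_pow, deg_coeffHom, add_zero]
    by_cases ht0 : t = 0
    · exact ⟨l, coeffHom _ c * SkewPoly.theta _ ^ m, 0, by
        rw [add_zero]; exact sub_eq_zero.1 (ht.symm.trans ht0), Or.inl rfl⟩
    · have hlt : deg t < d := by
        refine hd ▸ lt_of_le_of_ne hdegt fun h => cf_deg_ne_zero ht0 ?_
        rw [h, hcft]
      obtain ⟨n, q, r, h1, h2⟩ := ih _ hlt t rfl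
      refine ⟨l + n, coeffHom _ c * SkewPoly.theta _ ^ m * SRing.X α X ^ n + q, r, ?_, h2⟩
      rw [mul_add, add_assoc, ← h1, ht, pow_add, sub_mul]
      simp only [mul_assoc]
      abel

include hX in
/-- A nonzero right ideal `K` of `S` such that `S / K` has no `X`-torsion is generated by a
single element which is nonzero modulo `X`. -/
theorem exists_eq_span_of_saturated {K : Submodule (SRing α)ᵐᵒᵖ (SRing α)} (hK : K ≠ ⊥)
    (hsat : ∀ s, s * SRing.X α X ∈ K → s ∈ K) :
    ∃ z, K = Submodule.span (SRing α)ᵐᵒᵖ {z} ∧ red hk α z ≠ 0 := by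
  have hsat' : ∀ n s, s * SRing.X α X ^ n ∈ K → s ∈ K := by
    intro n
    induction n with
    | zero => simp
    | succ n ih => intro s h; rw [pow_succ, ← mul_assoc] at h; exact ih _ (hsat _ h)
  obtain ⟨s₀, hs₀, hs₀0⟩ := (Submodule.ne_bot_iff K).1 hK
  -- a nonzero element of minimal degree
  have hex : ∃ d, ∃ s ∈ K, s ≠ 0 ∧ deg s = d := ⟨_, s₀, hs₀, hs₀0, rfl⟩
  classical
  obtain ⟨s, hs, hs0, hsd⟩ := Nat.find_spec hex
  obtain ⟨n, z, h1, h2, h3⟩ := exists_eq_mul_X_pow hk hX hs0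
  have hzK : z ∈ K := hsat' n z (h1 ▸ hs)
  have hz0 : z ≠ 0 := by rintro rfl; simp at h3
  refine ⟨z, le_antisymm (fun t ht => ?_) ((Submodule.span_singleton_le_iff_mem _ _).2 hzK), h3⟩
  obtain ⟨l, q, r, hq, hr⟩ := exists_mul_X_pow_eq_mul_add hX hz0 t
  have hrK : r ∈ K := by
    have : r = t * SRing.X α X ^ l - z * q := by rw [hq]; abel
    rw [this]
    exact K.sub_mem (K.smul_mem (op (SRing.X α X ^ l)) ht) (K.smul_mem (op q) hzK)
  have hr0 : r = 0 := by
    by_contra h0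
    have hlt := hr.resolve_left h0
    rw [h2, hsd] at hlt
    exact Nat.find_min hex hlt ⟨r, hrK, h0, rfl⟩
  rw [hr0, add_zero] at hq
  exact mem_span_op_singleton.2 (exists_eq_mul_of_mul_X_pow_eq hk hX h3 hq)

end Principal

/-! ### Two-sided ideals of `S` -/

section Ideal

variable {k R : Type*} [Field k] [CommRing R] [IsDomain R] [IsDiscreteValuationRing R]
  [Algebra k R] {X : R} (hX : maximalIdeal R = Ideal.span {X}) {α : R ≃ₐ[k] R}

include hX in
/-- Since `α` has infinite order, every nonzero two-sided ideal of `S` contains a monomial: an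
element with the least number of terms is one, as it could otherwise be shortened by
commutation with an element of `R`. -/
theorem exists_X_pow_mul_theta_pow_mem (hα : ¬ IsOfFinOrder α) (I : AddSubgroup (SRing α))
    (hl : ∀ s, ∀ p ∈ I, s * p ∈ I) (hr : ∀ s, ∀ p ∈ I, p * s ∈ I) (hI : ∃ p ∈ I, p ≠ 0) :
    ∃ n m, SRing.X α X ^ n * SRing.theta α ^ m ∈ I := by
  have hex : ∃ d, ∃ p ∈ I, p ≠ 0 ∧ (SkewPolynomial.support p).card = d := by
    obtain ⟨p, hp, hp0⟩ := hI
    exact ⟨_, p, hp, hp0, rfl⟩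
  classical
  obtain ⟨p, hp, hp0, hd⟩ := Nat.find_spec hex
  have hpow : ∀ (n : ℕ) (r : R), ((α : R ≃+* R) ^ n) r = (α ^ n) r := by
    intro n
    induction n with
    | zero => intro r; rfl
    | succ n ih => intro r; rw [pow_succ', pow_succ']; exact congrArg α (ih r)
  have hmono : ∀ i, i ≠ deg p → cf p i = 0 := by
    intro i hi
    by_contra hci
    have hlt : i < deg p := lt_of_le_of_ne (le_deg_of_cf_ne_zero hci) hi
    obtain ⟨r, hr'⟩ : ∃ r, (α ^ deg p) r ≠ (α ^ i) r := by
      by_contra! h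
      refine hα (isOfFinOrder_iff_pow_eq_one.2 ⟨deg p - i, by omega, ?_⟩)
      have : α ^ deg p = α ^ i := AlgEquiv.ext h
      rw [← Nat.sub_add_cancel hlt.le, pow_add] at this
      simpa using this
    set q := coeffHom _ ((α ^ deg p) r) * p - p * coeffHom _ r with hq
    have hcf : ∀ n, cf q n = ((α ^ deg p) r - (α ^ n) r) * cf p n := by
      intro n
      rw [hq, cf_sub, cf_coeffHom_mul, cf_mul_coeffHom, hpow]
      ring
    have hqI : q ∈ I := I.sub_mem (hl _ _ hp) (hr _ _ hp)
    have hq0 : q ≠ 0 := by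
      intro h
      have := hcf i
      rw [h, cf_zero, zero_eq_mul] at this
      exact this.elim (fun h => hr' (sub_eq_zero.1 h)) hci
    have hcard : (SkewPolynomial.support q).card < (SkewPolynomial.support p).card := by
      refine Finset.card_lt_card ⟨fun n hn => ?_, fun h => ?_⟩
      · rw [mem_support_iff_cf] at hn ⊢
        exact fun h0 => hn (by rw [hcf, h0, mul_zero])
      · have := h (mem_support_iff_cf.2 (cf_deg_ne_zero hp0))
        rw [mem_support_iff_cf] at this
        exact this (by rw [hcf, sub_self, zero_mul])
    rw [hd] at hcard
    exact Nat.find_min hex hcard ⟨q, hqI, hq0, rfl⟩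
  obtain ⟨n, u, hu⟩ := IsDiscreteValuationRing.eq_unit_mul_pow_irreducible (cf_deg_ne_zero hp0)
    (irreducible_uniformizer hX)
  refine ⟨n, deg p, ?_⟩
  have : SRing.X α X ^ n * SRing.theta α ^ deg p = coeffHom _ (↑u⁻¹ : R) * p := by
    refine ext_cf fun i => ?_
    rw [SRing.X, ← map_pow, SRing.theta, cf_coeffHom_mul_theta_pow, cf_coeffHom_mul]
    split_ifs with hi
    · rw [← hi, hu, ← mul_assoc, u.inv_mul, one_mul]
    · rw [hmono i (Ne.symm hi), mul_zero]
  rw [this]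
  exact hl _ _ hp

end Ideal

end SRing

/-! ### Critical modules over a principal ideal domain -/

section Lattice

theorem isArtinian_quotient_iff {A M : Type*} [Ring A] [AddCommGroup M] [Module A M]
    (N : Submodule A M) : IsArtinian A (M ⧸ N) ↔ WellFoundedLT (Set.Ici N) :=
  ⟨fun _ => (Submodule.comapMkQRelIso N).symm.strictMono.wellFoundedLT,
    fun _ => (Submodule.comapMkQRelIso N).strictMono.wellFoundedLT⟩

/-- Being `1`-critical depends on the lattice of submodules only. -/
theorem IsKrullCritical.of_orderIso {A M B N : Type*} [Ring A] [AddCommGroup M] [Module A M]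
    [Ring B] [AddCommGroup N] [Module B N] (e : Submodule A M ≃o Submodule B N)
    (h : IsKrullCritical A 1 M) : IsKrullCritical B 1 N := by
  rw [isKrullCritical_one_iff] at h ⊢
  refine ⟨fun h' => h.1 ?_, fun K hK => ?_⟩
  · have : WellFoundedLT (Submodule B N) := h'
    exact e.strictMono.wellFoundedLT
  · have := (isArtinian_quotient_iff _).1 (h.2 (e.symm K) (by simpa using hK))
    refine (isArtinian_quotient_iff _).2 ?_
    let f : Set.Ici K → Set.Ici (e.symm K) := fun L => ⟨e.symm L, e.symm.monotone L.2⟩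
    have hf : StrictMono f := fun L L' h => e.symm.strictMono h
    exact hf.wellFoundedLT

variable {P M : Type*} [CommRing P] [IsDomain P] [IsPrincipalIdealRing P]
  [AddCommGroup M] [Module P M]

/-- A torsion cyclic module over a principal ideal domain is Artinian. -/
theorem isArtinian_span_singleton {p : P} (hp : p ≠ 0) {m : M} (h : p • m = 0) :
    IsArtinian P (Submodule.span P {m}) := by
  have := (isFiniteLength_iff_isNoetherian_isArtinian.1
    (isFiniteLength_quotient_span_singleton P (mem_nonZeroDivisors_of_ne_zero hp))).2
  have hle : Ideal.span {p} ≤ LinearMap.ker (LinearMap.toSpanSingleton P M m) := by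
    rw [Ideal.span_singleton_le_iff_mem]
    simpa using h
  let f := Submodule.liftQ _ _ hle
  have hf : LinearMap.range f = Submodule.span P {m} := by
    rw [Submodule.range_liftQ, LinearMap.range_toSpanSingleton]
  rw [← hf]
  infer_instance

/-- A finitely generated `1`-critical module over a principal ideal domain is free of rank `1`. -/
theorem IsKrullCritical.nonempty_linearEquiv_self (hP : ¬ IsField P) [Module.Finite P M]
    (h : IsKrullCritical P 1 M) : Nonempty (M ≃ₗ[P] P) := by
  have htf : Module.IsTorsionFree P M := by
    rw [Module.isTorsionFree_iff_smul_eq_zero]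
    intro p m hpm
    by_contra! hne
    exact h.not_isArtinian (by simpa using hne.2) (isArtinian_span_singleton hne.1 hpm)
  obtain ⟨n, b⟩ := Module.basisOfFiniteTypeTorsionFree' (R := P) (M := M)
  match n, b with
  | 0, b =>
    have : Subsingleton M := b.equivFun.toEquiv.subsingleton
    exact absurd (inferInstance : IsArtinian P M) (isKrullCritical_one_iff.1 h).1
  | 1, b => exact ⟨b.equivFun.trans (LinearEquiv.funUnique (Fin 1) P P)⟩
  | n + 2, b =>
    have hb0 : b 0 ≠ 0 := b.ne_zero 0
    have := (isKrullCritical_one_iff.1 h).2 (Submodule.span P {b 0}) (by simpa using hb0)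
    -- otherwise `P` would embed in the Artinian module `M / b₀P`, via the next basis vector
    let f : P →ₗ[P] M ⧸ Submodule.span P {b 0} :=
      (Submodule.mkQ _).comp (LinearMap.toSpanSingleton P M (b 1))
    have hf : Function.Injective f := by
      rw [injective_iff_map_eq_zero]
      intro p hp
      have hp' : p • b 1 ∈ Submodule.span P {b 0} := by
        rw [← Submodule.Quotient.mk_eq_zero]
        simpa [f] using hp
      obtain ⟨a, ha⟩ := Submodule.mem_span_singleton.1 hp'
      have := congrArg (fun m => b.repr m 1) ha
      simpa using this.symm
    have : IsArtinianRing P := isArtinian_of_injective f hf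
    exact absurd (IsArtinianRing.isField_of_isDomain P) hP

end Lattice

/-! ### Right modules: cyclic modules and hull-similarity -/

section RightModules

variable {D : Type*} [Ring D] {M : Type*} [AddCommGroup M] [Module Dᵐᵒᵖ M]

/-- The homomorphism `s ↦ m s` of right modules. -/
def rightMulHom (m : M) : D →ₗ[Dᵐᵒᵖ] M where
  toFun s := m <• s
  map_add' s t := by rw [op_add, add_smul]
  map_smul' a s := by
    rw [RingHom.id_apply, smul_smul]
    rfl

@[simp] theorem rightMulHom_apply (m : M) (s : D) : rightMulHom m s = m <• s := rfl

theorem range_rightMulHom (m : M) :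
    LinearMap.range (rightMulHom (D := D) m) = Submodule.span Dᵐᵒᵖ {m} := by
  ext x
  rw [Submodule.mem_span_singleton]
  exact ⟨fun ⟨s, hs⟩ => ⟨op s, hs⟩, fun ⟨s, hs⟩ => ⟨s.unop, hs⟩⟩

/-- `D / zD ≅ mD` if `zD` is the annihilator of `m`. -/
noncomputable def quotEquivSpan {m : M} {z : D}
    (h : ∀ s : D, m <• s = 0 ↔ ∃ q, s = z * q) :
    RightQuot z ≃ₗ[Dᵐᵒᵖ] Submodule.span Dᵐᵒᵖ {m} :=
  have hk : Submodule.span Dᵐᵒᵖ {z} = LinearMap.ker (rightMulHom (D := D) m) := by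
    ext s
    rw [mem_span_op_singleton, LinearMap.mem_ker, rightMulHom_apply, h]
  (Submodule.quotEquivOfEq _ _ hk).trans
    ((rightMulHom (D := D) m).quotKerEquivRange.trans
      (LinearEquiv.ofEq _ _ (range_rightMulHom m)))

/-- Cyclic submodules generated by elements with the same annihilator are isomorphic. -/
theorem nonempty_span_equiv_span {N : Type*} [AddCommGroup N] [Module Dᵐᵒᵖ N] {m : M} {n : N}
    (h : ∀ s : D, m <• s = 0 ↔ n <• s = 0) :
    Nonempty (Submodule.span Dᵐᵒᵖ {m} ≃ₗ[Dᵐᵒᵖ] Submodule.span Dᵐᵒᵖ {n}) := by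
  have hk : LinearMap.ker (rightMulHom (D := D) m) = LinearMap.ker (rightMulHom (D := D) n) := by
    ext s
    exact h s
  exact ⟨(LinearEquiv.ofEq _ _ (range_rightMulHom m).symm).trans
    ((rightMulHom (D := D) m).quotKerEquivRange.symm.trans
      ((Submodule.quotEquivOfEq _ _ hk).trans
        ((rightMulHom (D := D) n).quotKerEquivRange.trans
          (LinearEquiv.ofEq _ _ (range_rightMulHom n)))))⟩

/-- The class of `a` in `D / zD`. -/
def RightQuot.mk (z a : D) : RightQuot z := Submodule.Quotient.mk a

theorem RightQuot.mk_surjective (z : D) : Function.Surjective (RightQuot.mk z) :=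
  Submodule.Quotient.mk_surjective _

theorem RightQuot.mk_eq_zero {z a : D} : RightQuot.mk z a = 0 ↔ ∃ q, a = z * q :=
  (Submodule.Quotient.mk_eq_zero _).trans mem_span_op_singleton

theorem RightQuot.mk_smul (z a s : D) : RightQuot.mk z a <• s = RightQuot.mk z (a * s) := rfl

/-- Hull-similarity of cyclic modules in terms of annihilators of elements. -/
theorem hullSimilar_rightQuot_iff {z w : D} :
    HullSimilar Dᵐᵒᵖ (RightQuot z) (RightQuot w) ↔
      ∃ a b : D, (¬ ∃ q, a = z * q) ∧ ∀ s, (∃ q, a * s = z * q) ↔ ∃ q, b * s = w * q := by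
  constructor
  · rintro ⟨M', N', hne, ⟨e⟩⟩
    obtain ⟨m, hm, hm0⟩ := (Submodule.ne_bot_iff M').1 hne
    obtain ⟨a, rfl⟩ := RightQuot.mk_surjective z m
    obtain ⟨b, hb⟩ := RightQuot.mk_surjective w (e ⟨_, hm⟩ : N')
    refine ⟨a, b, fun h => hm0 (RightQuot.mk_eq_zero.2 h), fun s => ?_⟩
    rw [← RightQuot.mk_eq_zero, ← RightQuot.mk_eq_zero, ← RightQuot.mk_smul, ← RightQuot.mk_smul,
      hb, ← Submodule.coe_smul, ← map_smul, Submodule.coe_eq_zero, LinearEquiv.map_eq_zero_iff,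
      ← Submodule.coe_eq_zero]
    rfl
  · rintro ⟨a, b, ha, h⟩
    refine ⟨Submodule.span _ {RightQuot.mk z a}, Submodule.span _ {RightQuot.mk w b}, ?_,
      nonempty_span_equiv_span fun s => ?_⟩
    · rw [Ne, Submodule.span_singleton_eq_bot, RightQuot.mk_eq_zero]
      exact ha
    · rw [RightQuot.mk_smul, RightQuot.mk_smul, RightQuot.mk_eq_zero, RightQuot.mk_eq_zero, h]

section Retract

variable {P : Type*} [CommRing P] [Module P M] {π : D →+* P}

/-- If `D` acts on `M` through a surjection `D → P`, then `M` has the same `D`- and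
`P`-submodules. -/
def submoduleOrderIso (hπ : Function.Surjective π)
    (hact : ∀ (m : M) (s : D), m <• s = π s • m) : Submodule P M ≃o Submodule Dᵐᵒᵖ M where
  toFun N := { N with
    smul_mem' := fun s m hm => by
      rw [show s • m = π s.unop • m from hact m s.unop]
      exact N.smul_mem _ hm }
  invFun N := { N with
    smul_mem' := fun p m hm => by
      obtain ⟨s, rfl⟩ := hπ p
      rw [← hact]
      exact N.smul_mem _ hm }
  left_inv _ := rfl
  right_inv _ := rfl
  map_rel_iff' := Iff.rfl

/-- A right `D`-module as a module over a commutative ring `P` with a homomorphism `P → D`. -/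
abbrev moduleOfHom (ι : P →+* D) (M : Type*) [AddCommGroup M] [Module Dᵐᵒᵖ M] : Module P M :=
  Module.compHom M (ι.toOpposite fun x y => by
    rw [Commute, SemiconjBy, ← map_mul, mul_comm, map_mul])

omit [Module P M] in
/-- If `ι : P → D` splits a homomorphism `π : D → P` with kernel `cD`, then `D` acts through `π`
on the modules annihilated by `c`. -/
theorem smul_eq_of_split {ι : P →+* D} (hι : ∀ p, π (ι p) = p) {c : D}
    (hc : ∀ s, π s = 0 ↔ ∃ q, s = c * q) (hM : ∀ m : M, m <• c = 0) (m : M) (s : D) :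
    letI := moduleOfHom ι M
    m <• s = π s • m := by
  change m <• s = m <• ι (π s)
  obtain ⟨q, hq⟩ := (hc (s - ι (π s))).1 (by rw [map_sub, hι, sub_self])
  rw [← sub_eq_zero, ← sub_smul, ← op_sub, hq, op_mul, ← smul_smul, hM, smul_zero]

variable [IsDomain P] [IsPrincipalIdealRing P]

theorem isArtinian_of_span_singleton_eq_top (hπ : Function.Surjective π)
    (hact : ∀ (m : M) (s : D), m <• s = π s • m) {m : M}
    (hm : Submodule.span Dᵐᵒᵖ {m} = ⊤) {p : P} (hp : p ≠ 0) (hpm : p • m = 0) :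
    IsArtinian Dᵐᵒᵖ M := by
  have h1 := isArtinian_span_singleton hp hpm
  have h2 : Submodule.span P {m} = ⊤ := by
    rw [eq_top_iff]
    intro x _
    have hx : x ∈ Submodule.span Dᵐᵒᵖ {m} := hm ▸ Submodule.mem_top
    obtain ⟨s, rfl⟩ := Submodule.mem_span_singleton.1 hx
    exact Submodule.mem_span_singleton.2 ⟨π s.unop, (hact m s.unop).symm⟩
  rw [h2] at h1
  have h3 : WellFoundedLT (Submodule P M) :=
    isArtinian_of_linearEquiv (Submodule.topEquiv : (⊤ : Submodule P M) ≃ₗ[P] M)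
  exact (submoduleOrderIso hπ hact).symm.strictMono.wellFoundedLT

/-- If `D` acts on a finitely generated `1`-critical module through a surjection `D → P` to a
principal ideal domain with kernel `cD`, then the module is `D / cD`. -/
theorem IsKrullCritical.nonempty_equiv_rightQuot (hP : ¬ IsField P) (hπ : Function.Surjective π)
    {c : D} (hc : ∀ s, π s = 0 ↔ ∃ q, s = c * q)
    (hact : ∀ (m : M) (s : D), m <• s = π s • m) [Module.Finite Dᵐᵒᵖ M]
    (h : IsKrullCritical Dᵐᵒᵖ 1 M) : Nonempty (M ≃ₗ[Dᵐᵒᵖ] RightQuot c) := by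
  have hfin : Module.Finite P M := by
    obtain ⟨t, ht⟩ := Module.Finite.fg_top (R := Dᵐᵒᵖ) (M := M)
    refine ⟨t, ?_⟩
    apply (submoduleOrderIso hπ hact).injective
    rw [OrderIso.map_top, eq_top_iff, ← ht, Submodule.span_le]
    exact Submodule.subset_span (R := P)
  obtain ⟨e⟩ := (h.of_orderIso (submoduleOrderIso hπ hact).symm).nonempty_linearEquiv_self hP
  have hzero : ∀ s : D, (e.symm 1) <• s = 0 ↔ ∃ q, s = c * q := by
    intro s
    rw [← hc, hact, ← map_smul, LinearEquiv.map_eq_zero_iff, smul_eq_mul, mul_one]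
  have htop : Submodule.span Dᵐᵒᵖ {e.symm 1} = ⊤ := by
    rw [eq_top_iff]
    intro x _
    obtain ⟨s, hs⟩ := hπ (e x)
    refine Submodule.mem_span_singleton.2 ⟨op s, ?_⟩
    rw [hact, ← map_smul, hs, smul_eq_mul, mul_one, e.symm_apply_apply]
  exact ⟨((quotEquivSpan hzero).trans ((LinearEquiv.ofEq _ _ htop).trans Submodule.topEquiv)).symm⟩

end Retract

variable {c : D}

/-- If `M cⁿ = 0` and `M / Mc` is Artinian, then so is `M`. -/
theorem IsNormalElement.isArtinian_of_pow (hc : IsNormalElement c) {n : ℕ}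
    (hn : ∀ m : M, m <• c ^ n = 0) [IsArtinian Dᵐᵒᵖ (M ⧸ hc.range M)] : IsArtinian Dᵐᵒᵖ M := by
  let f : Submodule Dᵐᵒᵖ M → (Fin n → Submodule Dᵐᵒᵖ (M ⧸ hc.range M)) :=
    fun L i => ((hc.pow i).preimage L).map (hc.range M).mkQ
  have hf : StrictMono f := by
    intro L L' h
    refine lt_of_le_not_ge (fun i => Submodule.map_mono fun m hm => h.le hm) fun hle => ?_
    have key : ∀ i ≤ n, ∀ x ∈ L', ∃ m, x - m <• c ^ i ∈ L := by
      intro i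
      induction i with
      | zero => intro _ x _; exact ⟨x, by simp⟩
      | succ i ih =>
        intro hi x hx
        obtain ⟨m, hm⟩ := ih (by omega) x hx
        have hmL' : m ∈ (hc.pow i).preimage L' := by
          rw [IsNormalElement.mem_preimage]
          simpa using L'.sub_mem hx (h.le hm)
        have hm' : m ∈ hc.range M ⊔ (hc.pow i).preimage L := by
          rw [← Submodule.comap_map_mkQ]
          exact hle ⟨i, hi⟩ (Submodule.mem_map_of_mem hmL')
        obtain ⟨_, ⟨y, rfl⟩, l, hl, rfl⟩ := Submodule.mem_sup.1 hm'
        refine ⟨y, ?_⟩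
        rw [IsNormalElement.mem_preimage] at hl
        have := L.add_mem hm hl
        rw [smul_add, smul_smul, ← op_mul, ← pow_succ'] at this
        convert this using 1
        abel
    refine h.not_ge fun x hx => ?_
    obtain ⟨m, hm⟩ := key n le_rfl x hx
    rwa [hn, sub_zero] at hm
  exact hf.wellFoundedLT

end RightModules

/-! ### The modules `S / zS` -/

namespace SRing

open SkewPoly IsLocalRing

variable {k R : Type*} [Field k] [CommRing R] [IsDomain R] [IsDiscreteValuationRing R]
  [Algebra k R] (hk : Function.Bijective (algebraMap k (ResidueField R)))
  {X : R} (hX : maximalIdeal R = Ideal.span {X}) {α : R ≃ₐ[k] R}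

theorem red_surjective : Function.Surjective (red hk α) := fun f => ⟨_, red_ofPoly hk f⟩

include hk hX in
theorem not_isUnit_X : ¬ IsUnit (SRing.X α X) := fun hu => by
  have := hu.map (red hk α)
  rw [red_X hk hX] at this
  exact not_isUnit_zero this

include hX in
theorem red_eq_zero_iff {s : SRing α} : red hk α s = 0 ↔ ∃ q, s = SRing.X α X * q :=
  ⟨exists_eq_X_mul hk hX, by rintro ⟨q, rfl⟩; rw [map_mul, red_X hk hX, zero_mul]⟩

theorem isUnit_of_deg_eq_zero {a : SRing α} (ha : red hk α a ≠ 0) (h : deg a = 0) :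
    IsUnit a := by
  rw [eq_coeffHom_of_deg_eq_zero h] at ha ⊢
  refine IsUnit.map _ ?_
  by_contra hu
  refine ha ?_
  rw [red_coeffHom, (res_eq_zero_iff hk _).2 ((mem_maximalIdeal _).2 hu), Polynomial.C_0]

theorem natDegree_red_of_isUnit {u : SRing α} (hu : IsUnit u) : (red hk α u).natDegree = 0 :=
  Polynomial.natDegree_eq_zero_of_isUnit (hu.map (red hk α))

include hX in
theorem smul_X_eq_zero {z : SRing α} (hz : red hk α z ≠ 0) (m : RightQuot z)
    (h : m <• SRing.X α X = 0) : m = 0 := by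
  obtain ⟨a, rfl⟩ := RightQuot.mk_surjective z m
  rw [RightQuot.mk_smul, RightQuot.mk_eq_zero] at h
  obtain ⟨q, hq⟩ := h
  exact RightQuot.mk_eq_zero.2
    (exists_eq_mul_of_mul_X_pow_eq hk hX hz (n := 1) (q := q) (by simpa using hq))

/-- `θ` acts injectively on `S / zS`, since `S / θS ≅ R` is a domain and `z` is nonzero there. -/
theorem smul_theta_eq_zero {z : SRing α} (hz : Irreducible z)
    (hu : ∀ u : (SRing α)ˣ, (u : SRing α) * z ≠ SRing.theta α) (m : RightQuot z)
    (h : m <• SRing.theta α = 0) : m = 0 := by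
  have hunit : ¬ IsUnit (SRing.theta α) := fun h => by
    have h0 := h.map (constCoeff (α : R ≃+* R))
    rw [SRing.theta, constCoeff_apply, cf_theta, if_neg one_ne_zero] at h0
    exact not_isUnit_zero h0
  have hz0 : cf z 0 ≠ 0 := by
    intro h0
    obtain ⟨q, hq⟩ := exists_eq_mul_theta h0
    obtain ⟨u, rfl⟩ := (hz.isUnit_or_isUnit hq).resolve_right hunit
    exact hu u⁻¹ (by rw [hq, ← mul_assoc, u.inv_mul, one_mul]; rfl)
  obtain ⟨a, rfl⟩ := RightQuot.mk_surjective z m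
  rw [RightQuot.mk_smul, RightQuot.mk_eq_zero] at h
  obtain ⟨q, hq⟩ := h
  have hq0 : cf q 0 = 0 := by
    have := congrArg (constCoeff (α : R ≃+* R)) hq
    rw [map_mul, map_mul, SRing.theta, constCoeff_apply (SkewPoly.theta _), cf_theta,
      if_neg one_ne_zero, mul_zero, zero_eq_mul] at this
    exact this.resolve_left hz0
  obtain ⟨q', rfl⟩ := exists_eq_mul_theta hq0
  refine RightQuot.mk_eq_zero.2 ⟨q', mul_right_cancel₀ (theta_ne_zero (α : R ≃+* R)) ?_⟩
  rw [mul_assoc, ← hq]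
  rfl

include hX in
/-- The right ideal `{t | t Xⁿ ∈ K for some n}`. -/
def saturation (K : Submodule (SRing α)ᵐᵒᵖ (SRing α)) : Submodule (SRing α)ᵐᵒᵖ (SRing α) where
  carrier := {t | ∃ n : ℕ, t * SRing.X α X ^ n ∈ K}
  zero_mem' := ⟨0, by simp⟩
  add_mem' := by
    rintro a b ⟨n, hn⟩ ⟨m, hm⟩
    refine ⟨n + m, ?_⟩
    rw [add_mul, pow_add, ← mul_assoc, ← pow_add, add_comm n m, pow_add, ← mul_assoc]
    exact K.add_mem (K.smul_mem (op (SRing.X α X ^ m)) hn) (K.smul_mem (op (SRing.X α X ^ n)) hm)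
  smul_mem' := by
    rintro s t ⟨n, hn⟩
    obtain ⟨s', hs'⟩ := ((isNormalElement_X hX α).pow n).exists_mul_eq s.unop
    refine ⟨n, ?_⟩
    change t * s.unop * SRing.X α X ^ n ∈ K
    rw [mul_assoc, hs', ← mul_assoc]
    exact K.smul_mem (op s') hn

theorem mem_saturation {K : Submodule (SRing α)ᵐᵒᵖ (SRing α)} {t : SRing α} :
    t ∈ saturation hX K ↔ ∃ n : ℕ, t * SRing.X α X ^ n ∈ K := Iff.rfl

theorem le_saturation (K : Submodule (SRing α)ᵐᵒᵖ (SRing α)) : K ≤ saturation hX K :=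
  fun t ht => ⟨0, by simpa using ht⟩

theorem mem_saturation_of_mul_X {K : Submodule (SRing α)ᵐᵒᵖ (SRing α)} (s : SRing α)
    (h : s * SRing.X α X ∈ saturation hX K) : s ∈ saturation hX K := by
  obtain ⟨n, hn⟩ := h
  exact ⟨n + 1, by rwa [pow_succ', ← mul_assoc]⟩

/-- The saturation of a nonzero right ideal `K` is generated by one element. -/
theorem exists_saturation_eq_span {K : Submodule (SRing α)ᵐᵒᵖ (SRing α)} (hK : K ≠ ⊥) :
    ∃ w, saturation hX K = Submodule.span (SRing α)ᵐᵒᵖ {w} ∧ red hk α w ≠ 0 :=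
  exists_eq_span_of_saturated hk hX (fun h => hK (eq_bot_iff.2 (h ▸ le_saturation hX K)))
    (mem_saturation_of_mul_X hX)

include hX in
/-- If `z` is a nonzero constant modulo `X`, then every right ideal containing `z` is saturated:
`X` acts surjectively, hence injectively, on `S / zS` and its factor modules. -/
theorem mem_of_mul_X_mem {z : SRing α} {c : k} (hc : c ≠ 0) (hz : red hk α z = Polynomial.C c)
    {K : Submodule (SRing α)ᵐᵒᵖ (SRing α)} (hzK : z ∈ K) (t : SRing α)
    (ht : t * SRing.X α X ∈ K) : t ∈ K := by
  have hK : K ≠ ⊥ := by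
    rintro rfl
    rw [Submodule.mem_bot] at hzK
    rw [hzK, map_zero, eq_comm, Polynomial.C_eq_zero] at hz
    exact hc hz
  obtain ⟨w, hw, -⟩ := exists_saturation_eq_span hk hX hK
  obtain ⟨n, hn⟩ : w ∈ saturation hX K := hw ▸ Submodule.mem_span_singleton_self w
  -- `S = K + S Xⁿ`
  have hsup : ∀ (n : ℕ) (s : SRing α), ∃ e, s - e * SRing.X α X ^ n ∈ K := by
    intro n
    induction n with
    | zero => intro s; exact ⟨s, by simp⟩
    | succ n ih =>
      intro s
      obtain ⟨e, he⟩ := ih s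
      have hred : red hk α (e - z * ofPoly α (Polynomial.C c⁻¹ * red hk α e)) = 0 := by
        rw [map_sub, map_mul, red_ofPoly, hz, ← mul_assoc, ← Polynomial.C_mul, mul_inv_cancel₀ hc,
          Polynomial.C_1, one_mul, sub_self]
      obtain ⟨e', he'⟩ := exists_eq_mul_X hk hX hred
      refine ⟨e', ?_⟩
      have h1 : z * (ofPoly α (Polynomial.C c⁻¹ * red hk α e) * SRing.X α X ^ n) ∈ K :=
        K.smul_mem (op _) hzK
      have := K.add_mem he h1
      convert this using 1
      rw [pow_succ', ← mul_assoc, ← he', sub_mul, mul_assoc]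
      abel
  obtain ⟨e, he⟩ := hsup n t
  -- the chain of the right ideals `{s | s Xⁿ ∈ K}` is stationary from `n` on
  have hes : e ∈ saturation hX K := by
    refine ⟨n + 1, ?_⟩
    have h1 : (t - e * SRing.X α X ^ n) * SRing.X α X ∈ K := K.smul_mem (op _) he
    have := K.sub_mem ht h1
    rwa [← sub_mul, sub_sub_cancel, mul_assoc, ← pow_succ] at this
  rw [hw, mem_span_op_singleton] at hes
  obtain ⟨q, rfl⟩ := hes
  obtain ⟨q', hq'⟩ := ((isNormalElement_X hX α).pow n).exists_mul_eq q
  have h1 : w * q * SRing.X α X ^ n ∈ K := by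
    rw [mul_assoc, hq', ← mul_assoc]
    exact K.smul_mem (op q') hn
  simpa using K.add_mem he h1

include hX in
/-- If `z` is a nonzero constant modulo `X`, then `S / zS` is Artinian: its submodules correspond
to left divisors of `z`, which are separated by their degrees along a chain. -/
theorem isArtinian_rightQuot_of_red_eq_C {z : SRing α} {c : k} (hc : c ≠ 0)
    (hz : red hk α z = Polynomial.C c) : IsArtinian (SRing α)ᵐᵒᵖ (RightQuot z) := by
  have hz0 : z ≠ 0 := by
    rintro rfl
    rw [map_zero, eq_comm, Polynomial.C_eq_zero] at hz
    exact hc hz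
  rw [isArtinian_quotient_iff]
  have hgen : ∀ K : Set.Ici (Submodule.span (SRing α)ᵐᵒᵖ {z}),
      ∃ w, K.1 = Submodule.span (SRing α)ᵐᵒᵖ {w} ∧ red hk α w ≠ 0 := by
    rintro ⟨K, hK⟩
    have hzK : z ∈ K := hK (Submodule.mem_span_singleton_self z)
    refine exists_eq_span_of_saturated hk hX ?_ (mem_of_mul_X_mem hk hX hc hz hzK)
    rintro rfl
    exact hz0 (by simpa using hzK)
  choose w hw hw0 using hgen
  have hw0' : ∀ K, w K ≠ 0 := fun K h => hw0 K (by rw [h, map_zero])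
  have hmono : StrictMono fun K => deg z - deg (w K) := by
    intro K K' hlt
    have h1 : z ∈ K.1 := K.2 (Submodule.mem_span_singleton_self z)
    rw [hw, mem_span_op_singleton] at h1
    obtain ⟨b, hb⟩ := h1
    have h2 : w K ∈ K'.1 := hlt.le (by rw [hw K]; exact Submodule.mem_span_singleton_self _)
    rw [hw, mem_span_op_singleton] at h2
    obtain ⟨a, ha⟩ := h2
    have hb0 : b ≠ 0 := by rintro rfl; exact hz0 (by simpa using hb)
    have ha0 : a ≠ 0 := by rintro rfl; exact hw0' K (by simpa using ha)
    have ha1 : red hk α a ≠ 0 := fun h => hw0 K (by rw [ha, map_mul, h, mul_zero])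
    have hdeg : deg a ≠ 0 := by
      intro h
      obtain ⟨u, hu⟩ := isUnit_of_deg_eq_zero hk ha1 h
      refine hlt.not_ge (show K'.1 ≤ K.1 from ?_)
      rw [hw, hw, Submodule.span_singleton_le_iff_mem, mem_span_op_singleton]
      exact ⟨(u⁻¹ : (SRing α)ˣ), by rw [ha, ← hu, mul_assoc, u.mul_inv, mul_one]⟩
    have e1 : deg z = deg (w K) + deg b := by rw [← deg_mul (hw0' K) hb0, ← hb]
    have e2 : deg (w K) = deg (w K') + deg a := by rw [← deg_mul (hw0' K') ha0, ← ha]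
    change deg z - deg (w K) < deg z - deg (w K')
    omega
  exact hmono.wellFoundedLT

include hX in
/-- If `z` is nonconstant modulo `X`, then `X` acts injectively but not surjectively on `S / zS`. -/
theorem not_isArtinian_rightQuot {z : SRing α} (hz : 0 < (red hk α z).natDegree) :
    ¬ IsArtinian (SRing α)ᵐᵒᵖ (RightQuot z) := by
  intro h
  have hz0 : red hk α z ≠ 0 := by rintro h; simp [h] at hz
  obtain ⟨m, hm⟩ := (isNormalElement_X hX α).surjective_of_isArtinian (smul_X_eq_zero hk hX hz0)
    (RightQuot.mk z 1)
  obtain ⟨e, rfl⟩ := RightQuot.mk_surjective z m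
  rw [RightQuot.mk_smul, ← sub_eq_zero] at hm
  obtain ⟨q, hq⟩ := RightQuot.mk_eq_zero.1 (show RightQuot.mk z (1 - e * SRing.X α X) = 0 from hm)
  have := congrArg (red hk α) hq
  rw [map_sub, map_mul, red_X hk hX, mul_zero, sub_zero, map_one, map_mul] at this
  exact hz.ne' (Polynomial.natDegree_eq_zero_of_isUnit (IsUnit.of_mul_eq_one _ this.symm))

include hX in
/-- Type (C) in terms of reduction modulo `X`. -/
theorem isTypeC_iff {z : SRing α} : IsTypeC α X z ↔ Irreducible z ∧
    (∀ u : (SRing α)ˣ, (u : SRing α) * z ≠ SRing.theta α) ∧ 0 < (red hk α z).natDegree := by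
  refine and_congr_right fun _ => and_congr_right fun _ => ⟨?_, fun h => ?_⟩
  · rintro ⟨u, f, s, hf, hdeg, h⟩
    have h1 := congrArg (red hk α) h
    rw [map_mul, map_add, red_ofPoly, map_mul, red_X hk hX, zero_mul, add_zero] at h1
    have h2 : red hk α z ≠ 0 := by
      intro h; rw [h, mul_zero] at h1; exact hf.ne_zero h1.symm
    have h3 := Polynomial.natDegree_mul (u.isUnit.map (red hk α)).ne_zero h2
    rw [h1, natDegree_red_of_isUnit hk u.isUnit] at h3
    omega
  · have hlc : (red hk α z).leadingCoeff ≠ 0 := by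
      rw [Ne, Polynomial.leadingCoeff_eq_zero]
      intro h0
      simp [h0] at h
    let φ : k →+* SRing α := (coeffHom (α : R ≃+* R)).comp (algebraMap k R)
    let u : (SRing α)ˣ := Units.map φ (Units.mk0 _ (inv_ne_zero hlc))
    have hu : red hk α (u : SRing α) = Polynomial.C (red hk α z).leadingCoeff⁻¹ := by
      change red hk α (coeffHom _ (algebraMap k R _)) = _
      rw [red_coeffHom, res_algebraMap]
      rfl
    have hred : red hk α ((u : SRing α) * z - ofPoly α (red hk α (u * z))) = 0 := by
      rw [map_sub, red_ofPoly, sub_self]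
    obtain ⟨s, hs⟩ := exists_eq_X_mul hk hX hred
    refine ⟨u, red hk α (u * z), s, ?_, ?_, by rw [← hs]; abel⟩
    · rw [map_mul, hu, mul_comm]
      exact Polynomial.monic_mul_leadingCoeff_inv (by simpa using hlc)
    · rw [map_mul, hu, Polynomial.natDegree_C_mul (inv_ne_zero hlc)]
      exact h

include hk hX in
/-- If `z` is irreducible, then every right ideal properly containing `zS` contains a power of `X`:
its saturation is generated by a left divisor of `z`. -/
theorem exists_X_pow_mem {z : SRing α} (hz : Irreducible z)
    {K : Submodule (SRing α)ᵐᵒᵖ (SRing α)} (hK : Submodule.span (SRing α)ᵐᵒᵖ {z} < K) :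
    ∃ n : ℕ, SRing.X α X ^ n ∈ K := by
  have hzK : z ∈ K := hK.le (Submodule.mem_span_singleton_self z)
  have hK0 : K ≠ ⊥ := by
    rintro rfl
    exact not_lt_bot hK
  obtain ⟨w, hw, -⟩ := exists_saturation_eq_span hk hX hK0
  have h1 : z ∈ saturation hX K := le_saturation hX K hzK
  rw [hw, mem_span_op_singleton] at h1
  obtain ⟨a, ha⟩ := h1
  have h2 : (1 : SRing α) ∈ saturation hX K := by
    rw [hw, mem_span_op_singleton]
    rcases hz.isUnit_or_isUnit ha with hu | hu
    · obtain ⟨u, rfl⟩ := hu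
      exact ⟨(u⁻¹ : (SRing α)ˣ), u.mul_inv.symm⟩
    · obtain ⟨u, rfl⟩ := hu
      refine absurd ((le_saturation hX K).trans ?_) hK.not_ge
      rw [hw, Submodule.span_singleton_le_iff_mem, mem_span_op_singleton]
      exact ⟨(u⁻¹ : (SRing α)ˣ), by rw [ha, mul_assoc, u.mul_inv, mul_one]⟩
  simpa [mem_saturation] using h2

/-- The inclusion `k[θ] → S` as a ring homomorphism. -/
noncomputable def ofPolyHom (α : R ≃ₐ[k] R) : Polynomial k →+* SRing α :=
  Polynomial.eval₂RingHom' ((coeffHom (α : R ≃+* R)).comp (algebraMap k R)) (SRing.theta α)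
    fun c => by
      have := theta_mul_coeffHom (α : R ≃+* R) (algebraMap k R c)
      rw [show (α : R ≃+* R) (algebraMap k R c) = algebraMap k R c from α.commutes c] at this
      exact this.symm

theorem red_ofPolyHom (f : Polynomial k) : red hk α (ofPolyHom α f) = f := red_ofPoly hk f

include hX in
/-- If `K` contains a power of `X` and an element `z` which is nonzero modulo `X`, then `S / K` is
Artinian, since `S / (zS + XS)` is a proper quotient of `k[θ]`. -/
theorem isArtinian_quotient_of_X_pow_mem {z : SRing α} (hz : red hk α z ≠ 0)
    {K : Submodule (SRing α)ᵐᵒᵖ (SRing α)} (hzK : z ∈ K) {n : ℕ} (hn : SRing.X α X ^ n ∈ K) :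
    IsArtinian (SRing α)ᵐᵒᵖ (SRing α ⧸ K) := by
  have hN := isNormalElement_X hX α
  have hker : ∀ m : SRing α ⧸ K, m <• SRing.X α X ^ n = 0 := by
    intro m
    obtain ⟨s, rfl⟩ := Submodule.Quotient.mk_surjective _ m
    obtain ⟨s', hs'⟩ := (hN.pow n).exists_mul_eq s
    refine (Submodule.Quotient.mk_eq_zero K (x := s * SRing.X α X ^ n)).2 ?_
    rw [hs']
    exact K.smul_mem (op s') hn
  suffices IsArtinian (SRing α)ᵐᵒᵖ ((SRing α ⧸ K) ⧸ hN.range (SRing α ⧸ K)) from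
    hN.isArtinian_of_pow hker
  have hXM : ∀ m : (SRing α ⧸ K) ⧸ hN.range (SRing α ⧸ K), m <• SRing.X α X = 0 := by
    intro m
    obtain ⟨s, rfl⟩ := Submodule.Quotient.mk_surjective _ m
    exact (Submodule.Quotient.mk_eq_zero _ (x := s <• SRing.X α X)).2 ⟨s, rfl⟩
  let := moduleOfHom (ofPolyHom α) ((SRing α ⧸ K) ⧸ hN.range (SRing α ⧸ K))
  have hact := smul_eq_of_split (red_ofPolyHom hk) (fun _ => red_eq_zero_iff hk hX) hXM
  let m : (SRing α ⧸ K) ⧸ hN.range (SRing α ⧸ K) :=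
    (hN.range _).mkQ (K.mkQ 1)
  refine isArtinian_of_span_singleton_eq_top (red_surjective hk) hact (m := m) ?_ hz ?_
  · rw [eq_top_iff]
    intro x _
    obtain ⟨y, rfl⟩ := Submodule.Quotient.mk_surjective _ x
    obtain ⟨s, rfl⟩ := Submodule.Quotient.mk_surjective _ y
    refine Submodule.mem_span_singleton.2 ⟨op s, ?_⟩
    rw [← map_smul, ← map_smul, op_smul_eq_mul, one_mul]
    rfl
  · rw [← hact, ← map_smul, ← map_smul, op_smul_eq_mul, one_mul, Submodule.mkQ_apply K,
      (Submodule.Quotient.mk_eq_zero K).2 hzK, map_zero]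

end SRing

/-! ### Faithful and unfaithful `1`-critical modules over `S` -/

namespace SRing

open SkewPoly IsLocalRing

variable {k R : Type*} [Field k] [CommRing R] [IsDomain R] [IsDiscreteValuationRing R]
  [Algebra k R] (hk : Function.Bijective (algebraMap k (ResidueField R)))
  {X : R} (hX : maximalIdeal R = Ideal.span {X}) {α : R ≃ₐ[k] R}

section

include hk hX

/-- If `z` is irreducible and nonconstant modulo `X`, then `S / zS` is `1`-critical: a right ideal
properly containing `zS` contains a power of `X`. -/
theorem isKrullCritical_rightQuot {z : SRing α} (hz : Irreducible z)
    (hdeg : 0 < (red hk α z).natDegree) : IsKrullCritical (SRing α)ᵐᵒᵖ 1 (RightQuot z) := by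
  have hz0 : red hk α z ≠ 0 := by rintro h; simp [h] at hdeg
  refine isKrullCritical_one_iff.2 ⟨not_isArtinian_rightQuot hk hX hdeg, fun N hN => ?_⟩
  have hle := Submodule.le_comap_mkQ (Submodule.span (SRing α)ᵐᵒᵖ {z}) N
  have hlt : Submodule.span (SRing α)ᵐᵒᵖ {z} < N.comap (Submodule.mkQ _) := by
    refine lt_of_le_of_ne hle fun h => hN ?_
    rw [← Submodule.map_comap_eq_of_surjective (Submodule.mkQ_surjective _) N, ← h,
      Submodule.mkQ_map_self]
  obtain ⟨n, hn⟩ := exists_X_pow_mem hk hX hz hlt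
  have := isArtinian_quotient_of_X_pow_mem hk hX hz0
    (hle (Submodule.mem_span_singleton_self z)) hn
  refine isArtinian_of_surjective _
    ((N.comap (Submodule.mkQ _)).mapQ N (Submodule.mkQ _) le_rfl) ?_
  intro x
  obtain ⟨y, rfl⟩ := Submodule.Quotient.mk_surjective _ x
  obtain ⟨s, rfl⟩ := Submodule.Quotient.mk_surjective _ y
  exact ⟨Submodule.Quotient.mk s, rfl⟩

variable {M : Type*} [AddCommGroup M] [Module (SRing α)ᵐᵒᵖ M]

omit hk in
theorem exists_smul_X_pow_smul_theta_pow_eq_zero (hα : ¬ IsOfFinOrder α)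
    (hM : ¬ FaithfulSMul (SRing α)ᵐᵒᵖ M) :
    ∃ n m : ℕ, ∀ x : M, x <• (SRing.X α X ^ n * SRing.theta α ^ m) = 0 := by
  let I : AddSubgroup (SRing α) :=
    { carrier := {s | ∀ x : M, x <• s = 0}
      zero_mem' := fun x => by simp
      add_mem' := fun ha hb x => by rw [op_add, add_smul, ha, hb, add_zero]
      neg_mem' := fun ha x => by rw [op_neg, neg_smul, ha, neg_zero] }
  refine exists_X_pow_mul_theta_pow_mem hX hα I ?_ ?_ ?_
  · intro s p hp x
    rw [op_mul, ← smul_smul]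
    exact hp _
  · intro s p hp x
    rw [op_mul, ← smul_smul, hp, smul_zero]
  · by_contra! h
    refine hM ⟨fun {a b} hab => ?_⟩
    have := h (a - b).unop fun x => by rw [op_unop, sub_smul, hab, sub_self]
    exact sub_eq_zero.1 (unop_injective this)

omit hk in
/-- A nonzero module on which `X` and `θ` act injectively is faithful. -/
theorem faithfulSMul_of_injective (hα : ¬ IsOfFinOrder α) [Nontrivial M]
    (h1 : ∀ m : M, m <• SRing.X α X = 0 → m = 0)
    (h2 : ∀ m : M, m <• SRing.theta α = 0 → m = 0) : FaithfulSMul (SRing α)ᵐᵒᵖ M := by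
  by_contra hM
  obtain ⟨n, l, h⟩ := exists_smul_X_pow_smul_theta_pow_eq_zero hX hα hM
  have hpow : ∀ c : SRing α, (∀ m : M, m <• c = 0 → m = 0) →
      ∀ (n : ℕ) (m : M), m <• (c ^ n) = 0 → m = 0 := by
    intro c hc n
    induction n with
    | zero => simp
    | succ n ih =>
      intro m hm
      rw [pow_succ, op_mul, ← smul_smul] at hm
      exact ih _ (hc _ hm)
  obtain ⟨x, hx⟩ := exists_ne (0 : M)
  have h3 := h x
  rw [op_mul, ← smul_smul] at h3
  exact hx (hpow _ h1 n x (hpow _ h2 l _ h3))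

/-- `X` and `θ` act injectively on `S / zS` for `z` of type (C). -/
theorem faithfulSMul_rightQuot (hα : ¬ IsOfFinOrder α) {z : SRing α} (hz : IsTypeC α X z) :
    FaithfulSMul (SRing α)ᵐᵒᵖ (RightQuot z) := by
  obtain ⟨h1, h2, h3⟩ := (isTypeC_iff hk hX).1 hz
  have hz0 : red hk α z ≠ 0 := by rintro h; simp [h] at h3
  have : Nontrivial (RightQuot z) := by
    by_contra h
    rw [not_nontrivial_iff_subsingleton] at h
    exact not_isArtinian_rightQuot hk hX h3 inferInstance
  exact faithfulSMul_of_injective hX hα (smul_X_eq_zero hk hX hz0) (smul_theta_eq_zero h1 h2)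

theorem nonempty_equiv_of_not_faithfulSMul (hα : ¬ IsOfFinOrder α)
    [Module.Finite (SRing α)ᵐᵒᵖ M] (hM : IsKrullCritical (SRing α)ᵐᵒᵖ 1 M)
    (hf : ¬ FaithfulSMul (SRing α)ᵐᵒᵖ M) :
    Nonempty (M ≃ₗ[(SRing α)ᵐᵒᵖ] RightQuot (SRing.X α X)) ∨
      Nonempty (M ≃ₗ[(SRing α)ᵐᵒᵖ] RightQuot (SRing.theta α)) := by
  rcases hM.smul_eq_zero_or_injective (isNormalElement_X hX α) with h1 | h1
  · left
    let := moduleOfHom (ofPolyHom α) M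
    exact hM.nonempty_equiv_rightQuot (Polynomial.not_isField k) (red_surjective hk)
      (fun _ => red_eq_zero_iff hk hX)
      (smul_eq_of_split (red_ofPolyHom hk) (fun _ => red_eq_zero_iff hk hX) h1)
  rcases hM.smul_eq_zero_or_injective (isNormalElement_theta (α : R ≃+* R)) with h2 | h2
  · right
    let := moduleOfHom (coeffHom (α : R ≃+* R)) M
    have hsplit : ∀ r, constCoeff (α : R ≃+* R) (coeffHom _ r) = r := fun r => by
      rw [constCoeff_apply, cf_coeffHom, if_pos rfl]
    have hker : ∀ s, constCoeff (α : R ≃+* R) s = 0 ↔ ∃ q, s = SRing.theta α * q :=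
      fun s => ⟨exists_eq_theta_mul, by
        rintro ⟨q, rfl⟩
        rw [map_mul, SRing.theta, constCoeff_apply, cf_theta, if_neg one_ne_zero, zero_mul]⟩
    exact hM.nonempty_equiv_rightQuot (IsDiscreteValuationRing.not_isField R)
      (fun r => ⟨_, hsplit r⟩) hker (smul_eq_of_split hsplit hker h2)
  · have : Nontrivial M := by
      by_contra h
      rw [not_nontrivial_iff_subsingleton] at h
      exact (isKrullCritical_one_iff.1 hM).1 inferInstance
    exact absurd (faithfulSMul_of_injective hX hα h1 h2) hf

/-- The normal element `θ` acts injectively but not surjectively on `S / XS ≅ k[θ]`. -/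
theorem not_isArtinian_rightQuot_X : ¬ IsArtinian (SRing α)ᵐᵒᵖ (RightQuot (SRing.X α X)) := by
  intro h
  obtain ⟨m, hm⟩ := (isNormalElement_theta (α : R ≃+* R)).surjective_of_isArtinian (M :=
    RightQuot (SRing.X α X)) (fun m h => by
      obtain ⟨a, rfl⟩ := RightQuot.mk_surjective _ m
      rw [RightQuot.mk_smul, RightQuot.mk_eq_zero, ← red_eq_zero_iff hk hX, map_mul,
        show red hk α (SkewPoly.theta _) = Polynomial.X from red_theta hk, mul_eq_zero] at h
      exact RightQuot.mk_eq_zero.2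
        ((red_eq_zero_iff hk hX).1 (h.resolve_right Polynomial.X_ne_zero)))
    (RightQuot.mk _ 1)
  obtain ⟨e, rfl⟩ := RightQuot.mk_surjective _ m
  rw [RightQuot.mk_smul, ← sub_eq_zero] at hm
  have h1 := RightQuot.mk_eq_zero.1
    (show RightQuot.mk (SRing.X α X) (1 - e * SkewPoly.theta _) = 0 from hm)
  rw [← red_eq_zero_iff hk hX, map_sub, map_one, map_mul,
    show red hk α (SkewPoly.theta _) = Polynomial.X from red_theta hk, sub_eq_zero] at h1
  exact Polynomial.not_isUnit_X (IsUnit.of_mul_eq_one_right _ h1.symm)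

/-- In a `1`-critical module on which `X` acts injectively, every annihilator of a nonzero element
is generated by one element. It is nonzero, as otherwise `S / XS` would embed in the Artinian
module `M / mXS`. -/
theorem exists_annihilator_eq (hM : IsKrullCritical (SRing α)ᵐᵒᵖ 1 M)
    (h1 : ∀ m : M, m <• SRing.X α X = 0 → m = 0) {m : M} (hm : m ≠ 0) :
    ∃ z : SRing α, (∀ s, m <• s = 0 ↔ ∃ q, s = z * q) ∧ red hk α z ≠ 0 := by
  have hK : LinearMap.ker (rightMulHom (D := SRing α) m) ≠ ⊥ := by
    intro hbot
    have hinj : ∀ s : SRing α, m <• s = 0 → s = 0 := fun s hs => by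
      have : s ∈ LinearMap.ker (rightMulHom (D := SRing α) m) := hs
      simpa [hbot] using this
    let N := Submodule.span (SRing α)ᵐᵒᵖ {m <• SRing.X α X}
    have hN : N ≠ ⊥ := by
      rw [Ne, Submodule.span_singleton_eq_bot]
      exact fun h => hm (h1 m h)
    have := (isKrullCritical_one_iff.1 hM).2 N hN
    let f : SRing α →ₗ[(SRing α)ᵐᵒᵖ] M ⧸ N := N.mkQ.comp (rightMulHom m)
    have hker : Submodule.span (SRing α)ᵐᵒᵖ {SRing.X α X} = LinearMap.ker f := by
      ext s
      have : s ∈ LinearMap.ker f ↔ m <• s ∈ N := Submodule.Quotient.mk_eq_zero N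
      rw [this, mem_span_op_singleton, Submodule.mem_span_singleton]
      constructor
      · rintro ⟨q, rfl⟩
        exact ⟨op q, by rw [smul_smul, ← op_mul]⟩
      · rintro ⟨q, hq⟩
        refine ⟨q.unop, sub_eq_zero.1 (hinj _ ?_)⟩
        rw [op_sub, sub_smul, ← hq, op_mul, op_unop, ← smul_smul, sub_self]
    refine not_isArtinian_rightQuot_X (α := α) hk hX
      (isArtinian_of_injective (Submodule.liftQ _ f hker.le) ?_)
    rw [← LinearMap.ker_eq_bot, Submodule.ker_liftQ_eq_bot _ _ _ hker.ge]
  obtain ⟨z, hz, hz0⟩ := exists_eq_span_of_saturated hk hX hK fun s hs => by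
    refine h1 _ ?_
    rw [rightMulHom_apply, smul_smul, ← op_mul]
    exact hs
  refine ⟨z, fun s => ?_, hz0⟩
  rw [← mem_span_op_singleton, ← hz]
  rfl

/-- A generator of least degree among the annihilators of nonzero elements is irreducible. -/
theorem exists_isTypeC_of_faithfulSMul (hM : IsKrullCritical (SRing α)ᵐᵒᵖ 1 M)
    (hf : FaithfulSMul (SRing α)ᵐᵒᵖ M) :
    ∃ (z : SRing α) (m : M), IsTypeC α X z ∧ m ≠ 0 ∧ ∀ s, m <• s = 0 ↔ ∃ q, s = z * q := by
  have hinj : ∀ c : SRing α, c ≠ 0 → IsNormalElement c → ∀ m : M, m <• c = 0 → m = 0 := by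
    intro c hc0 hc
    refine (hM.smul_eq_zero_or_injective hc).resolve_left fun h => hc0 ?_
    have : op c = (0 : (SRing α)ᵐᵒᵖ) := hf.eq_of_smul_eq_smul fun m => by rw [h, zero_smul]
    exact op_injective this
  have h1 := hinj _ (X_ne_zero hX α) (isNormalElement_X hX α)
  have h2 := hinj _ (theta_ne_zero (α : R ≃+* R)) (isNormalElement_theta _)
  have hex : ∃ d, ∃ (m : M) (z : SRing α), m ≠ 0 ∧ (∀ s, m <• s = 0 ↔ ∃ q, s = z * q) ∧
      red hk α z ≠ 0 ∧ deg z = d := by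
    have : Nontrivial M := by
      by_contra h
      rw [not_nontrivial_iff_subsingleton] at h
      exact (isKrullCritical_one_iff.1 hM).1 inferInstance
    obtain ⟨m, hm⟩ := exists_ne (0 : M)
    obtain ⟨z, hz, hz0⟩ := exists_annihilator_eq hk hX hM h1 hm
    exact ⟨_, m, z, hm, hz, hz0, rfl⟩
  classical
  obtain ⟨m, z, hm, hz, hz0, hd⟩ := Nat.find_spec hex
  have hmz : m <• z = 0 := (hz z).2 ⟨1, by rw [mul_one]⟩
  refine ⟨z, m, (isTypeC_iff hk hX).2 ⟨⟨?_, ?_⟩, ?_, ?_⟩, hm, hz⟩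
  · rintro ⟨u, rfl⟩
    apply hm
    have := congrArg (fun x : M => x <• ((u⁻¹ : (SRing α)ˣ) : SRing α)) hmz
    simpa [smul_smul, ← op_mul] using this
  · intro a b hab
    by_contra! hne
    have ha : red hk α a ≠ 0 := fun h => hz0 (by rw [hab, map_mul, h, zero_mul])
    have hb : red hk α b ≠ 0 := fun h => hz0 (by rw [hab, map_mul, h, mul_zero])
    have ha0 : a ≠ 0 := by rintro rfl; simp at ha
    have hb0 : b ≠ 0 := by rintro rfl; simp at hb
    have hdeg : deg a ≠ 0 := fun h => hne.1 (isUnit_of_deg_eq_zero hk ha h)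
    have hlt : deg b < Nat.find hex := by
      rw [← hd, hab, deg_mul ha0 hb0]
      omega
    refine Nat.find_min hex hlt ⟨m <• a, b, fun h => ?_, fun s => ?_, hb, rfl⟩
    · obtain ⟨q, hq⟩ := (hz a).1 h
      refine hne.2 (IsUnit.of_mul_eq_one q (mul_left_cancel₀ ha0 ?_))
      rw [mul_one, ← mul_assoc, ← hab, ← hq]
    · rw [smul_smul, ← op_mul, hz, hab]
      refine exists_congr fun q => ?_
      rw [mul_assoc, mul_right_inj' ha0]
  · intro u hu
    have hz' : z = (u⁻¹ : (SRing α)ˣ) * SRing.theta α := by rw [← hu, u.inv_mul_cancel_left]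
    rw [hz', op_mul, ← smul_smul] at hmz
    have h3 := h2 _ hmz
    have := congrArg (fun x : M => x <• (u : SRing α)) h3
    refine hm ?_
    simpa [smul_smul, ← op_mul] using this
  · by_contra hdeg
    obtain ⟨c, hc⟩ : ∃ c, red hk α z = Polynomial.C c :=
      ⟨_, Polynomial.eq_C_of_natDegree_eq_zero (by omega)⟩
    have hc0 : c ≠ 0 := by rintro rfl; exact hz0 (by rw [hc, Polynomial.C_0])
    have := isArtinian_rightQuot_of_red_eq_C hk hX hc0 hc
    exact hM.not_isArtinian (N := Submodule.span (SRing α)ᵐᵒᵖ {m})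
      (by rwa [Ne, Submodule.span_singleton_eq_bot]) (isArtinian_of_linearEquiv (quotEquivSpan hz))

end

end SRing

/-! ### Similarity and isomorphism of `D / aD` and `D / bD` -/

section Similarity

variable {D : Type*} [Ring D]

theorem RightQuot.map_mk {M : Type*} [AddCommGroup M] [Module Dᵐᵒᵖ M] {z : D}
    (φ : RightQuot z →ₗ[Dᵐᵒᵖ] M) (s : D) : φ (RightQuot.mk z s) = φ (RightQuot.mk z 1) <• s := by
  rw [← map_smul, RightQuot.mk_smul, one_mul]

theorem IsSimilar.nonempty_equiv [NoZeroDivisors D] {a b : D} (h : IsSimilar a b) :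
    Nonempty (RightQuot a ≃ₗ[Dᵐᵒᵖ] RightQuot b) := by
  obtain ⟨u, hu, hsup, hinf⟩ := h
  have hann : ∀ s : D, (RightQuot.mk b u) <• s = 0 ↔ ∃ q, s = a * q := by
    intro s
    have h1 : (u * s ∈ Submodule.span Dᵐᵒᵖ {u} ⊓ Submodule.span Dᵐᵒᵖ {b}) ↔
        ∃ q, u * s = b * q := by
      rw [Submodule.mem_inf, mem_span_op_singleton, mem_span_op_singleton]
      exact and_iff_right ⟨s, rfl⟩
    rw [RightQuot.mk_smul, RightQuot.mk_eq_zero, ← h1, ← hinf, mem_span_op_singleton]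
    refine exists_congr fun q => ?_
    rw [mul_assoc, mul_right_inj' hu]
  have htop : Submodule.span Dᵐᵒᵖ {RightQuot.mk b u} = ⊤ := by
    rw [eq_top_iff]
    intro x _
    obtain ⟨s, rfl⟩ := RightQuot.mk_surjective b x
    have hs : s ∈ Submodule.span Dᵐᵒᵖ {u} ⊔ Submodule.span Dᵐᵒᵖ {b} := hsup ▸ Submodule.mem_top
    obtain ⟨_, hy, _, hw, rfl⟩ := Submodule.mem_sup.1 hs
    obtain ⟨p, rfl⟩ := mem_span_op_singleton.1 hy
    obtain ⟨q, rfl⟩ := mem_span_op_singleton.1 hw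
    refine Submodule.mem_span_singleton.2 ⟨op p, ?_⟩
    rw [RightQuot.mk_smul, ← sub_eq_zero]
    exact (Submodule.Quotient.mk_eq_zero _ (x := u * p - (u * p + b * q))).2
      (mem_span_op_singleton.2 ⟨-q, by rw [mul_neg]; abel⟩)
  exact ⟨(quotEquivSpan hann).trans ((LinearEquiv.ofEq _ _ htop).trans Submodule.topEquiv)⟩

theorem IsSimilar.of_equiv {a b : D} [Nontrivial (RightQuot b)]
    (φ : RightQuot a ≃ₗ[Dᵐᵒᵖ] RightQuot b) : IsSimilar a b := by
  obtain ⟨u, hu⟩ := RightQuot.mk_surjective b (φ (RightQuot.mk a 1))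
  have hφ : ∀ s, φ (RightQuot.mk a s) = RightQuot.mk b (u * s) := fun s => by
    rw [← RightQuot.mk_smul, hu]
    exact RightQuot.map_mk φ.toLinearMap s
  have hiff : ∀ s, (∃ q, u * s = b * q) ↔ ∃ q, s = a * q := fun s => by
    rw [← RightQuot.mk_eq_zero, ← hφ, LinearEquiv.map_eq_zero_iff, RightQuot.mk_eq_zero]
  have hsurj : ∀ s, ∃ p q, s = u * p + b * q := by
    intro s
    obtain ⟨x, hx⟩ := φ.surjective (RightQuot.mk b s)
    obtain ⟨p, rfl⟩ := RightQuot.mk_surjective a x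
    rw [hφ, eq_comm, ← sub_eq_zero] at hx
    obtain ⟨q, hq⟩ := RightQuot.mk_eq_zero.1 (show RightQuot.mk b (s - u * p) = 0 from hx)
    exact ⟨p, q, by rw [← hq]; abel⟩
  refine ⟨u, ?_, ?_, ?_⟩
  · rintro rfl
    obtain ⟨x, hx⟩ := exists_ne (0 : RightQuot b)
    obtain ⟨s, rfl⟩ := RightQuot.mk_surjective b x
    obtain ⟨p, q, hpq⟩ := hsurj s
    exact hx (RightQuot.mk_eq_zero.2 ⟨q, by rw [hpq, zero_mul, zero_add]⟩)
  · rw [eq_top_iff]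
    intro s _
    obtain ⟨p, q, rfl⟩ := hsurj s
    exact Submodule.add_mem_sup (mem_span_op_singleton.2 ⟨p, rfl⟩)
      (mem_span_op_singleton.2 ⟨q, rfl⟩)
  · ext s
    rw [Submodule.mem_inf]
    simp only [mem_span_op_singleton]
    constructor
    · rintro ⟨q, rfl⟩
      refine ⟨⟨a * q, mul_assoc _ _ _⟩, ?_⟩
      rw [mul_assoc]
      exact (hiff _).2 ⟨q, rfl⟩
    · rintro ⟨⟨p, rfl⟩, h⟩
      obtain ⟨q, rfl⟩ := (hiff p).1 h
      exact ⟨q, (mul_assoc _ _ _).symm⟩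

end Similarity

/-! ### Comparison of `S` with its localisation `T` -/

namespace SRing

open SkewPoly IsLocalRing

variable {k R : Type*} [Field k] [CommRing R] [IsDomain R] [IsDiscreteValuationRing R]
  [Algebra k R] (hk : Function.Bijective (algebraMap k (ResidueField R)))
  {X : R} (hX : maximalIdeal R = Ideal.span {X}) {α : R ≃ₐ[k] R}

section

include hk hX

omit hk in
theorem isUnit_toT_X : IsUnit (toT α (SRing.X α X)) :=
  isUnit_toT α (irreducible_uniformizer hX).ne_zero

/-- `zT ∩ S = zS` if `z` is nonzero modulo `X`. -/
theorem exists_toT_eq_iff {z : SRing α} (hz : red hk α z ≠ 0) (s : SRing α) :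
    (∃ q, toT α s = toT α z * q) ↔ ∃ q, s = z * q := by
  refine ⟨?_, fun ⟨q, hq⟩ => ⟨toT α q, by rw [hq, map_mul]⟩⟩
  rintro ⟨t, ht⟩
  obtain ⟨n, q, hq⟩ := exists_toT_eq_mul_pow α hX t
  refine exists_eq_mul_of_mul_X_pow_eq hk hX hz (n := n) (q := q) (toT_injective α ?_)
  rw [map_mul, map_mul, hq, ht, map_pow, mul_assoc]
  rfl

/-- Annihilators in `T / zT` are determined by annihilators in `S / zS`. -/
theorem forall_exists_toT_eq_iff {z w : SRing α} (hz : red hk α z ≠ 0) (hw : red hk α w ≠ 0)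
    (a b : SRing α) :
    (∀ t, (∃ q, toT α a * t = toT α z * q) ↔ ∃ q, toT α b * t = toT α w * q) ↔
      ∀ s, (∃ q, a * s = z * q) ↔ ∃ q, b * s = w * q := by
  constructor
  · intro h s
    have := h (toT α s)
    rwa [← map_mul, ← map_mul, exists_toT_eq_iff hk hX hz, exists_toT_eq_iff hk hX hw] at this
  · intro h t
    obtain ⟨n, s, hs⟩ := exists_toT_eq_mul_pow α hX t
    obtain ⟨v, hv⟩ := (isUnit_toT_X (α := α) hX).pow n
    have key : ∀ c y : SRing α, (∃ q, toT α c * t = toT α y * q) ↔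
        ∃ q, toT α (c * s) = toT α y * q := by
      intro c y
      have hs' : toT α s = t * v := hs.trans (congrArg (t * ·) hv.symm)
      rw [map_mul, hs', ← mul_assoc]
      constructor
      · rintro ⟨q, hq⟩
        exact ⟨q * v, by rw [hq, mul_assoc]⟩
      · rintro ⟨q, hq⟩
        refine ⟨q * (v⁻¹ : (TRing α)ˣ), ?_⟩
        rw [← mul_assoc, ← hq, mul_assoc, v.mul_inv, mul_one]
    rw [key, key, exists_toT_eq_iff hk hX hz, exists_toT_eq_iff hk hX hw, h]

/-- A right ideal of `T` properly containing `zT` meets `S` in a right ideal properly containing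
`zS`, hence contains a power of the unit `X`. -/
theorem isSimpleModule_rightQuot_toT {z : SRing α} (hz : Irreducible z) (hz0 : red hk α z ≠ 0) :
    IsSimpleModule (TRing α)ᵐᵒᵖ (RightQuot (toT α z)) := by
  rw [isSimpleModule_iff_isCoatom]
  constructor
  · intro h
    have h1 : (1 : TRing α) ∈ Submodule.span (TRing α)ᵐᵒᵖ {toT α z} := h ▸ Submodule.mem_top
    rw [mem_span_op_singleton, ← map_one (toT α), exists_toT_eq_iff hk hX hz0] at h1
    obtain ⟨q, hq⟩ := h1
    exact hz.not_isUnit (IsUnit.of_mul_eq_one q hq.symm)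
  · intro J hJ
    let K : Submodule (SRing α)ᵐᵒᵖ (SRing α) :=
      { carrier := {s | toT α s ∈ J}
        zero_mem' := by simp
        add_mem' := fun {a b} ha hb => by
          change toT α (a + b) ∈ J
          rw [map_add]
          exact J.add_mem ha hb
        smul_mem' := fun s t ht => by
          change toT α (t * s.unop) ∈ J
          rw [map_mul]
          exact J.smul_mem (op (toT α s.unop)) ht }
    have hzK : z ∈ K := hJ.le (Submodule.mem_span_singleton_self _)
    obtain ⟨t, htJ, ht⟩ := SetLike.exists_of_lt hJ
    have hlt : Submodule.span (SRing α)ᵐᵒᵖ {z} < K := by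
      refine lt_of_le_of_ne ((Submodule.span_singleton_le_iff_mem _ _).2 hzK) fun h => ht ?_
      obtain ⟨n, s, hs⟩ := exists_toT_eq_mul_pow α hX t
      obtain ⟨v, hv⟩ := (isUnit_toT_X (α := α) hX).pow n
      have hs' : toT α s = t * v := hs.trans (congrArg (t * ·) hv.symm)
      have hsK : s ∈ K := by
        change toT α s ∈ J
        rw [hs']
        exact J.smul_mem (op (v : TRing α)) htJ
      rw [← h, mem_span_op_singleton] at hsK
      obtain ⟨q, rfl⟩ := hsK
      rw [mem_span_op_singleton]
      refine ⟨toT α q * (v⁻¹ : (TRing α)ˣ), ?_⟩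
      rw [← mul_assoc, ← map_mul, hs', mul_assoc, v.mul_inv, mul_one]
    obtain ⟨n, hn⟩ := exists_X_pow_mem hk hX hz hlt
    have hn' : toT α (SRing.X α X ^ n) ∈ J := hn
    rw [map_pow] at hn'
    obtain ⟨v, hv⟩ := (isUnit_toT_X (α := α) hX).pow n
    rw [← hv] at hn'
    rw [eq_top_iff]
    intro x _
    have := J.smul_mem (op ((v⁻¹ : (TRing α)ˣ) * x)) hn'
    rwa [op_smul_eq_mul, v.mul_inv_cancel_left] at this

/-- An irreducible element of `S` which is not a unit of `T` is nonzero modulo `X`. -/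
theorem red_ne_zero_of_nontrivial {w : SRing α} (hw : Irreducible w)
    [Nontrivial (RightQuot (toT α w))] : red hk α w ≠ 0 := by
  intro h
  obtain ⟨q, hq⟩ := exists_eq_X_mul hk hX h
  have hqu := (hw.isUnit_or_isUnit hq).resolve_left (not_isUnit_X hk hX)
  obtain ⟨v, hv⟩ : IsUnit (toT α w) := by
    rw [hq, map_mul]
    exact (isUnit_toT_X hX).mul (hqu.map (toT α))
  obtain ⟨x, hx⟩ := exists_ne (0 : RightQuot (toT α w))
  obtain ⟨s, rfl⟩ := RightQuot.mk_surjective _ x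
  exact hx (RightQuot.mk_eq_zero.2
    ⟨(v⁻¹ : (TRing α)ˣ) * s, by rw [← hv, v.mul_inv_cancel_left]⟩)

/-- For irreducible `w` not of type (C), `S / wS` is annihilated by `X` or `θ` or is Artinian,
whereas no nonzero submodule of `S / zS` has one of these properties. -/
theorem isTypeC_of_hullSimilar {z w : SRing α} (hz : IsTypeC α X z) (hw : Irreducible w)
    (h : HullSimilar (SRing α)ᵐᵒᵖ (RightQuot z) (RightQuot w)) : IsTypeC α X w := by
  obtain ⟨hzi, hzθ, hzd⟩ := (isTypeC_iff hk hX).1 hz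
  have hz0 : red hk α z ≠ 0 := by rintro h; simp [h] at hzd
  obtain ⟨a, b, ha, hab⟩ := hullSimilar_rightQuot_iff.1 h
  have hma : RightQuot.mk z a ≠ 0 := fun h => ha (RightQuot.mk_eq_zero.1 h)
  have hw0 : red hk α w ≠ 0 := by
    -- otherwise `wS = XS`, so that `X` annihilates `S / wS`
    intro h
    obtain ⟨q, hq⟩ := exists_eq_X_mul hk hX h
    obtain ⟨v, rfl⟩ := (hw.isUnit_or_isUnit hq).resolve_left (not_isUnit_X hk hX)
    obtain ⟨b', hb'⟩ := (isNormalElement_X hX α).exists_mul_eq b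
    refine hma (smul_X_eq_zero hk hX hz0 _ (RightQuot.mk_eq_zero.2 ((hab _).2
      ⟨(v⁻¹ : (SRing α)ˣ) * b', ?_⟩)))
    rw [unop_op, hb', hq, mul_assoc, v.mul_inv_cancel_left]
  refine (isTypeC_iff hk hX).2 ⟨hw, fun u hu => ?_, ?_⟩
  · -- otherwise `wS = θS`, so that `θ` annihilates `S / wS`
    obtain ⟨v, hv⟩ := (isNormalElement_theta (α : R ≃+* R)).exists_mul_eq (u : SRing α)
    obtain ⟨b', hb'⟩ := (isNormalElement_theta (α : R ≃+* R)).exists_mul_eq b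
    have hθ : SRing.theta α = w * v := by
      have hw' : w = (u⁻¹ : (SRing α)ˣ) * SRing.theta α := by rw [← hu, u.inv_mul_cancel_left]
      rw [hw', mul_assoc]
      exact (Units.eq_inv_mul_iff_mul_eq u).2 hv
    refine hma (smul_theta_eq_zero hzi hzθ _ (RightQuot.mk_eq_zero.2 ((hab _).2
      ⟨v * b', ?_⟩)))
    rw [← mul_assoc, ← hθ]
    exact hb'
  · by_contra hdeg
    obtain ⟨c, hc⟩ : ∃ c, red hk α w = Polynomial.C c :=
      ⟨_, Polynomial.eq_C_of_natDegree_eq_zero (by omega)⟩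
    have hc0 : c ≠ 0 := by rintro rfl; exact hw0 (by rw [hc, Polynomial.C_0])
    have := isArtinian_rightQuot_of_red_eq_C hk hX hc0 hc
    obtain ⟨M', N', hne, ⟨e⟩⟩ := h
    exact (isKrullCritical_rightQuot hk hX hzi hzd).not_isArtinian hne
      (isArtinian_of_linearEquiv e.symm)

theorem nonempty_equiv_of_hullSimilar {z w : SRing α} (hz : Irreducible z) (hw : Irreducible w)
    (hz0 : red hk α z ≠ 0) (hw0 : red hk α w ≠ 0)
    (h : HullSimilar (SRing α)ᵐᵒᵖ (RightQuot z) (RightQuot w)) :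
    Nonempty (RightQuot (toT α z) ≃ₗ[(TRing α)ᵐᵒᵖ] RightQuot (toT α w)) := by
  obtain ⟨a, b, ha, hab⟩ := hullSimilar_rightQuot_iff.1 h
  have := isSimpleModule_rightQuot_toT hk hX hz hz0
  have := isSimpleModule_rightQuot_toT hk hX hw hw0
  have hb : ¬ ∃ q, b = w * q := fun hb => ha (by simpa using (hab 1).2 (by simpa using hb))
  have htop : ∀ {y c : SRing α}, red hk α y ≠ 0 →
      IsSimpleModule (TRing α)ᵐᵒᵖ (RightQuot (toT α y)) → (¬ ∃ q, c = y * q) →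
      Submodule.span (TRing α)ᵐᵒᵖ {RightQuot.mk (toT α y) (toT α c)} = ⊤ := by
    intro y c hy _ hc
    refine (eq_bot_or_eq_top _).resolve_left ?_
    rw [Submodule.span_singleton_eq_bot, RightQuot.mk_eq_zero, exists_toT_eq_iff hk hX hy]
    exact hc
  obtain ⟨e⟩ := nonempty_span_equiv_span (m := RightQuot.mk (toT α z) (toT α a))
    (n := RightQuot.mk (toT α w) (toT α b)) fun t => by
      rw [RightQuot.mk_smul, RightQuot.mk_smul, RightQuot.mk_eq_zero, RightQuot.mk_eq_zero]
      exact (forall_exists_toT_eq_iff hk hX hz0 hw0 a b).2 hab t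
  exact ⟨Submodule.topEquiv.symm.trans ((LinearEquiv.ofEq _ _ (htop hz0 ‹_› ha).symm).trans
    (e.trans ((LinearEquiv.ofEq _ _ (htop hw0 ‹_› hb)).trans Submodule.topEquiv)))⟩

/-- The image of `1` under an isomorphism `T / zT ≅ T / wT` is the class of `b X⁻ⁿ` for some `b` in
`S`, and so the classes of `Xⁿ` and `b` have the same annihilator. -/
theorem hullSimilar_of_equiv {z w : SRing α} (hw : Irreducible w) (hz0 : red hk α z ≠ 0)
    [Nontrivial (RightQuot (toT α w))]
    (φ : RightQuot (toT α z) ≃ₗ[(TRing α)ᵐᵒᵖ] RightQuot (toT α w)) :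
    HullSimilar (SRing α)ᵐᵒᵖ (RightQuot z) (RightQuot w) := by
  have hw0 := red_ne_zero_of_nontrivial hk hX hw
  obtain ⟨b₀, hb₀⟩ := RightQuot.mk_surjective _ (φ (RightQuot.mk _ 1))
  obtain ⟨n, b, hb⟩ := exists_toT_eq_mul_pow α hX b₀
  have hann : ∀ t, (∃ q, toT α (SRing.X α X ^ n) * t = toT α z * q) ↔
      ∃ q, toT α b * t = toT α w * q := by
    intro t
    rw [← RightQuot.mk_eq_zero, ← RightQuot.mk_eq_zero, ← LinearEquiv.map_eq_zero_iff φ,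
      show φ (RightQuot.mk _ _) = _ from RightQuot.map_mk φ.toLinearMap _]
    change φ (RightQuot.mk _ 1) <• _ = 0 ↔ _
    rw [← hb₀, RightQuot.mk_smul, hb, map_pow, mul_assoc]
    rfl
  refine hullSimilar_rightQuot_iff.2 ⟨SRing.X α X ^ n, b, fun h => ?_,
    (forall_exists_toT_eq_iff hk hX hz0 hw0 _ _).1 hann⟩
  rw [← exists_toT_eq_iff hk hX hz0, map_pow] at h
  obtain ⟨q, hq⟩ := h
  obtain ⟨v, hv⟩ := (isUnit_toT_X (α := α) hX).pow n
  obtain ⟨x, hx⟩ := exists_ne (0 : RightQuot (toT α w))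
  obtain ⟨y, rfl⟩ := φ.surjective x
  obtain ⟨s, rfl⟩ := RightQuot.mk_surjective _ y
  refine hx ((LinearEquiv.map_eq_zero_iff φ).2 (RightQuot.mk_eq_zero.2
    ⟨q * ((v⁻¹ : (TRing α)ˣ) * s), ?_⟩))
  rw [← mul_assoc, ← hq, ← hv, v.mul_inv_cancel_left]

end

end SRing

end

theorem mainTheorem3 {k : Type*} {R : Type*} [Field k] [CommRing R] [IsDomain R]
    [IsDiscreteValuationRing R] [Algebra k R]
    (hk : Function.Bijective (algebraMap k (IsLocalRing.ResidueField R)))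
    (X : R) (hX : IsLocalRing.maximalIdeal R = Ideal.span {X})
    (α : R ≃ₐ[k] R) (hα : ¬ IsOfFinOrder α) :
    (∀ (M : Type*) [AddCommGroup M] [Module (SRing α)ᵐᵒᵖ M],
      Module.Finite (SRing α)ᵐᵒᵖ M → IsKrullCritical (SRing α)ᵐᵒᵖ 1 M →
        (¬ FaithfulSMul (SRing α)ᵐᵒᵖ M →
          Nonempty (M ≃ₗ[(SRing α)ᵐᵒᵖ] RightQuot (SRing.X α X)) ∨
          Nonempty (M ≃ₗ[(SRing α)ᵐᵒᵖ] RightQuot (SRing.theta α))) ∧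
        (FaithfulSMul (SRing α)ᵐᵒᵖ M →
          ∃ z : SRing α, SRing.IsTypeC α X z ∧
            HullSimilar (SRing α)ᵐᵒᵖ M (RightQuot z) ∧
            ∃ N : Submodule (SRing α)ᵐᵒᵖ M,
              Nonempty (RightQuot z ≃ₗ[(SRing α)ᵐᵒᵖ] N))) ∧
    (∀ z : SRing α, SRing.IsTypeC α X z →
      FaithfulSMul (SRing α)ᵐᵒᵖ (RightQuot z) ∧
      (⊤ : Submodule (SRing α)ᵐᵒᵖ (RightQuot z)).IsPrincipal ∧
      IsKrullCritical (SRing α)ᵐᵒᵖ 1 (RightQuot z)) ∧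
    (∀ z w : SRing α, SRing.IsTypeC α X z → Irreducible w →
      [ HullSimilar (SRing α)ᵐᵒᵖ (RightQuot z) (RightQuot w),
        IsSimpleModule (TRing α)ᵐᵒᵖ (RightQuot (SRing.toT α z)) ∧
          IsSimpleModule (TRing α)ᵐᵒᵖ (RightQuot (SRing.toT α w)) ∧
          Nonempty (RightQuot (SRing.toT α z) ≃ₗ[(TRing α)ᵐᵒᵖ] RightQuot (SRing.toT α w)),
        IsSimilar (SRing.toT α z) (SRing.toT α w) ].TFAE ∧
      (HullSimilar (SRing α)ᵐᵒᵖ (RightQuot z) (RightQuot w) → SRing.IsTypeC α X w)) := by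
  refine ⟨fun M _ _ _ hM => ⟨fun hf => SRing.nonempty_equiv_of_not_faithfulSMul hk hX hα hM hf,
    fun hf => ?_⟩, fun z hz => ?_, fun z w hz hw => ?_⟩
  · obtain ⟨z, m, hz, hm, hann⟩ := SRing.exists_isTypeC_of_faithfulSMul hk hX hM hf
    let e := quotEquivSpan hann
    refine ⟨z, hz, ⟨_, ⊤, ?_, ⟨e.symm.trans Submodule.topEquiv.symm⟩⟩, _, ⟨e⟩⟩
    rwa [Ne, Submodule.span_singleton_eq_bot]
  · obtain ⟨h1, -, h3⟩ := (SRing.isTypeC_iff hk hX).1 hz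
    refine ⟨SRing.faithfulSMul_rightQuot hk hX hα hz, ⟨RightQuot.mk z 1, ?_⟩,
      SRing.isKrullCritical_rightQuot hk hX h1 h3⟩
    rw [eq_comm, eq_top_iff]
    intro x _
    obtain ⟨s, rfl⟩ := RightQuot.mk_surjective z x
    exact Submodule.mem_span_singleton.2 ⟨MulOpposite.op s, by rw [RightQuot.mk_smul, one_mul]⟩
  · obtain ⟨hzi, -, hzd⟩ := (SRing.isTypeC_iff hk hX).1 hz
    have hz0 : SRing.red hk α z ≠ 0 := by rintro h; simp [h] at hzd
    have hsimple := SRing.isSimpleModule_rightQuot_toT hk hX hzi hz0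
    refine ⟨?_, SRing.isTypeC_of_hullSimilar hk hX hz hw⟩
    tfae_have 1 → 2 := by
      intro h
      have hwC := (SRing.isTypeC_iff hk hX).1 (SRing.isTypeC_of_hullSimilar hk hX hz hw h)
      have hw0 : SRing.red hk α w ≠ 0 := by
        intro h0
        simp [h0] at hwC
      exact ⟨hsimple, SRing.isSimpleModule_rightQuot_toT hk hX hw hw0,
        SRing.nonempty_equiv_of_hullSimilar hk hX hzi hw hz0 hw0 h⟩
    tfae_have 2 → 3 := by
      rintro ⟨-, h, ⟨φ⟩⟩
      have := IsSimpleModule.nontrivial (TRing α)ᵐᵒᵖ (RightQuot (SRing.toT α w))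
      exact IsSimilar.of_equiv φ
    tfae_have 3 → 1 := by
      intro h
      obtain ⟨φ⟩ := h.nonempty_equiv
      have := IsSimpleModule.nontrivial (TRing α)ᵐᵒᵖ (RightQuot (SRing.toT α z))
      have : Nontrivial (RightQuot (SRing.toT α w)) := φ.symm.toEquiv.nontrivial
      exact SRing.hullSimilar_of_equiv hk hX hw hz0 φ
    tfae_finish
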